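/- Let $M$ be a smooth (Hausdorff, finite-dimensional, real) manifold with an almost complex structure $J$, i.e. a smooth $(1,1)$-tensor field with $J^2=-\mathrm{Id}$, and let $N_J(X,Y)=[JX,JY]-J[X,JY]-J[JX,Y]-[X,Y]$ be its Nijenhuis tensor. Let $\nabla$ be a smooth connection on $TM$ with torsion $T(X,Y)=\nabla_XY-\nabla_YX-[X,Y]$, and put $$(\nabla J)(X,Y)=\nabla_X(JY)-J\nabla_XY,\qquad [\nabla J](X,Y)=-(\nabla J)(X,Y)+(\nabla J)(Y,X),$$ $$S(X,Y)=-(\nabla J)(X,Y)+(\nabla J)(Y,X)+T(JX,Y)-J\,T(X,Y).$$ Let $\pi:T^*M\to M$ be the projection, let $\theta_\xi=\xi\circ d_\xi\pi$ be the Liouville form on $T^*M$, $\omega_{st}=d\theta$ the canonical symplectic form, and $\theta(J)_\xi=\xi\circ J\circ d_\xi\pi$, where $d\alpha(X,Y)=X\alpha(Y)-Y\alpha(X)-\alpha([X,Y])$. For a tensor field $R$ of type $(1,2)$ on $M$ let $\gamma(R)$ be the endomorphism field of $T(T^*M)$ given in local coordinates $(x,p)$ by $\gamma(R)=p_kR^k_{i,j}\,dx^i\otimes\partial_{p_j}$.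 Consider the following endomorphism fields of $T(T^*M)$. (a) The complete lift $J^c$ of $J$, defined by $d(\theta(J))=\omega_{st}(J^c\cdot,\cdot)$, and Satô's lift $\tilde J=J^c-\frac12\gamma(JN_J)$. (b) The Ishihara–Yano horizontal lift $J^{H,\nabla}=J^c+\gamma([\tilde\nabla J])$, where $\tilde\nabla=\nabla-\frac12T$. (c) The generalized horizontal lift $J^{G,\nabla}$. For $\xi\in T^*M$ with $x=\pi(\xi)$ let $H^\nabla_\xi$ be the set of all $d_xs(X)$ with $X\in T_xM$ and $s$ a smooth section of $T^*M$ such that $s(x)=\xi$ and $\nabla_Xs=0$ at $x$, for the connection on $T^*M$ induced by $\nabla$, $(\nabla_Xs)(Y)=X.s(Y)-s(\nabla_XY)$. Then $T_\xi T^*M=H^\nabla_\xi\oplus T^*_xM$, where $T_x^*M$ is embedded as the vertical space and $d_\xi\pi$ identifies $H^\nabla_\xi$ with $T_xM$, and in this decomposition $J^{G,\nabla}_\xi=J_x\oplus{}^tJ_x$. The connection $\nabla$ is called almost complex if $\nabla_X(JY)=J\nabla_XY$ for all smooth vector fields $X,Y$, and minimal if $T=\frac14N_J$. Then: (1) For every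 connection $\nabla$, $J^{G,\nabla}=\tilde J$ if and only if $S=-\frac12JN_J$. (2) For every connection $\nabla$, $J^{G,\nabla}=J^{H,\nabla}$ if and only if $T(JX,Y)=T(X,JY)$ for all $X,Y$. (3) For every almost complex minimal connection $\nabla$, $J^{G,\nabla}=\tilde J=J^{H,\nabla}$. -/

import Mathlib

open Bundle Manifold
open scoped ContDiff Topology

/-! ## The cotangent bundle of a smooth manifold modelled on a normed space `E` -/

/-- The cotangent space at a point. -/
abbrev CotangentSpace (E : Type*) [NormedAddCommGroup E] [NormedSpace ℝ E]
    {M : Type*} [TopologicalSpace M] [ChartedSpace E M] (x : M) : Type _ :=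
  TangentSpace 𝓘(ℝ, E) x →L[ℝ] ℝ

/-- The total space of the cotangent bundle; a point `ξ` has a base point `ξ.proj` and a covector
`ξ.2` at `ξ.proj`. -/
abbrev CotangentBundle (E : Type*) [NormedAddCommGroup E] [NormedSpace ℝ E]
    (M : Type*) [TopologicalSpace M] [ChartedSpace E M] : Type _ :=
  TotalSpace (E →L[ℝ] ℝ) (CotangentSpace E (M := M))

/-- The model of the manifold `T^*M`. -/
noncomputable abbrev cotangentModel (E : Type*) [NormedAddCommGroup E] [NormedSpace ℝ E] :=
  𝓘(ℝ, E).prod 𝓘(ℝ, E →L[ℝ] ℝ)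

/-- The tangent space of the manifold `T^*M` at `ξ`. -/
abbrev CotangentBundle.Tangent {E : Type*} [NormedAddCommGroup E] [NormedSpace ℝ E]
    {M : Type*} [TopologicalSpace M] [ChartedSpace E M] [IsManifold 𝓘(ℝ, E) ∞ M]
    (ξ : CotangentBundle E M) : Type _ :=
  TangentSpace (cotangentModel E) ξ

/-- Connections on `M`, that is, covariant derivatives on `TM`; `∇_X Y` at `x` is
written `cov Y x (X x)`. -/
abbrev Connection (E : Type*) [NormedAddCommGroup E] [NormedSpace ℝ E]
    (M : Type*) [TopologicalSpace M] [ChartedSpace E M] [IsManifold 𝓘(ℝ, E) ∞ M] : Type _ :=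
  CovariantDerivative 𝓘(ℝ, E) E (TangentSpace 𝓘(ℝ, E) : M → Type _)

/-- Tensor fields on `M`, twice covariant and once contravariant. -/
abbrev BilinearTensor (E : Type*) [NormedAddCommGroup E] [NormedSpace ℝ E]
    (M : Type*) [TopologicalSpace M] [ChartedSpace E M] : Type _ :=
  ∀ x : M, TangentSpace 𝓘(ℝ, E) x →L[ℝ] TangentSpace 𝓘(ℝ, E) x →L[ℝ] TangentSpace 𝓘(ℝ, E) x

/-- Fields of endomorphisms of the tangent spaces of `T^*M`. -/
abbrev CotangentEndomorphism (E : Type*) [NormedAddCommGroup E] [NormedSpace ℝ E]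
    (M : Type*) [TopologicalSpace M] [ChartedSpace E M] [IsManifold 𝓘(ℝ, E) ∞ M] : Type _ :=
  ∀ ξ : CotangentBundle E M, ξ.Tangent →ₗ[ℝ] ξ.Tangent

instance TangentSpace.instFiniteDimensionalSelf {E : Type*} [NormedAddCommGroup E]
    [NormedSpace ℝ E] [FiniteDimensional ℝ E] {M : Type*} [TopologicalSpace M] [ChartedSpace E M]
    (x : M) : FiniteDimensional ℝ (TangentSpace 𝓘(ℝ, E) x) :=
  inferInstanceAs (FiniteDimensional ℝ E)

instance TangentSpace.instT2SpaceSelf {E : Type*} [NormedAddCommGroup E]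
    [NormedSpace ℝ E] {M : Type*} [TopologicalSpace M] [ChartedSpace E M]
    (x : M) : T2Space (TangentSpace 𝓘(ℝ, E) x) :=
  inferInstanceAs (T2Space E)

instance CotangentBundle.instFiniteDimensionalTangent {E : Type*} [NormedAddCommGroup E]
    [NormedSpace ℝ E] [FiniteDimensional ℝ E] {M : Type*} [TopologicalSpace M] [ChartedSpace E M]
    [IsManifold 𝓘(ℝ, E) ∞ M] (ξ : CotangentBundle E M) : FiniteDimensional ℝ ξ.Tangent :=
  inferInstanceAs (FiniteDimensional ℝ (E × (E →L[ℝ] ℝ)))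

section Basic

variable {E : Type*} [NormedAddCommGroup E] [NormedSpace ℝ E]
  {M : Type*} [TopologicalSpace M] [ChartedSpace E M]

/-- `X ∈ Γ(TM)`: a smooth vector field. -/
def IsSmoothVectorField [IsManifold 𝓘(ℝ, E) ∞ M] (X : ∀ x : M, TangentSpace 𝓘(ℝ, E) x) : Prop :=
  ContMDiff 𝓘(ℝ, E) (𝓘(ℝ, E).prod 𝓘(ℝ, E)) ∞ (fun x ↦ TotalSpace.mk' E x (X x))

/-- `s ∈ Γ(T^*M)`: a smooth one-form on `M`. -/
def IsSmoothCovectorField [IsManifold 𝓘(ℝ, E) ∞ M] (s : ∀ x : M, CotangentSpace E x) : Prop :=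
  ContMDiff 𝓘(ℝ, E) (cotangentModel E) ∞ (fun x ↦ TotalSpace.mk' (E →L[ℝ] ℝ) x (s x))

/-- The exterior derivative of a one-form on a manifold (without boundary, in the uses below),
computed at `q` in the preferred chart at `q`:
`dα(u, v) = (D_u α)(v) - (D_v α)(u)`, which is the convention
`dα(X, Y) = X(α(Y)) - Y(α(X)) - α([X, Y])`. -/
noncomputable def exteriorDerivative {F : Type*} [NormedAddCommGroup F] [NormedSpace ℝ F]
    {H : Type*} [TopologicalSpace H] (I : ModelWithCorners ℝ F H)
    {N : Type*} [TopologicalSpace N] [ChartedSpace H N]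
    (α : ∀ q : N, TangentSpace I q →L[ℝ] ℝ) (q : N) :
    TangentSpace I q →ₗ[ℝ] TangentSpace I q →ₗ[ℝ] ℝ :=
  let φ := extChartAt I q
  let D : F →L[ℝ] F →L[ℝ] ℝ := fderivWithin ℝ
    (fun y ↦ (α (φ.symm y)).comp (mfderivWithin 𝓘(ℝ, F) I φ.symm (Set.range I) y))
    (Set.range I) (φ q)
  let L : TangentSpace I q →L[ℝ] F := mfderiv I 𝓘(ℝ, F) φ q
  LinearMap.mk₂ ℝ (fun u v ↦ D (L u) (L v) - D (L v) (L u))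
    (fun u u' v ↦ by simp only [map_add, add_apply]; ring)
    (fun c u v ↦ by simp only [map_smul, smul_apply, smul_eq_mul]; ring)
    (fun u v v' ↦ by simp only [map_add, add_apply]; ring)
    (fun c u v ↦ by simp only [map_smul, smul_apply, smul_eq_mul]; ring)

end Basic

/-! ## Almost complex structures -/

/-- An almost complex structure on `M`: a smooth tensor field `J` of type `(1,1)` with
`J ∘ J = -Id`. -/
structure AlmostComplexStructure (E : Type*) [NormedAddCommGroup E] [NormedSpace ℝ E]
    (M : Type*) [TopologicalSpace M] [ChartedSpace E M] [IsManifold 𝓘(ℝ, E) ∞ M] where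
  toFun : ∀ x : M, TangentSpace 𝓘(ℝ, E) x →L[ℝ] TangentSpace 𝓘(ℝ, E) x
  contMDiff' : ContMDiff 𝓘(ℝ, E) (𝓘(ℝ, E).prod 𝓘(ℝ, E →L[ℝ] E)) ∞
    (fun x ↦ TotalSpace.mk' (E →L[ℝ] E) x (toFun x))
  sq' : ∀ (x : M) (v : TangentSpace 𝓘(ℝ, E) x), toFun x (toFun x v) = -v

namespace AlmostComplexStructure

variable {E : Type*} [NormedAddCommGroup E] [NormedSpace ℝ E]
  {M : Type*} [TopologicalSpace M] [ChartedSpace E M] [IsManifold 𝓘(ℝ, E) ∞ M]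

instance : CoeFun (AlmostComplexStructure E M)
    fun _ ↦ ∀ x : M, TangentSpace 𝓘(ℝ, E) x →L[ℝ] TangentSpace 𝓘(ℝ, E) x := ⟨toFun⟩

variable (J : AlmostComplexStructure E M)

/-- The vector field `JX`. -/
noncomputable def onField (X : ∀ x : M, TangentSpace 𝓘(ℝ, E) x) : ∀ x : M, TangentSpace 𝓘(ℝ, E) x :=
  fun x ↦ J x (X x)

open VectorField in
/-- `[JX, JY] - J[X, JY] - J[JX, Y] - [X, Y]` for vector fields `X`, `Y`. -/
noncomputable def nijenhuisField (X Y : ∀ x : M, TangentSpace 𝓘(ℝ, E) x) (x : M) :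
    TangentSpace 𝓘(ℝ, E) x :=
  mlieBracket 𝓘(ℝ, E) (J.onField X) (J.onField Y) x
    - J x (mlieBracket 𝓘(ℝ, E) X (J.onField Y) x)
    - J x (mlieBracket 𝓘(ℝ, E) (J.onField X) Y x)
    - mlieBracket 𝓘(ℝ, E) X Y x

theorem mdifferentiableAt_onField {X : ∀ x : M, TangentSpace 𝓘(ℝ, E) x} {x : M}
    (hX : MDiffAt (T% X) x) : MDiffAt (T% (J.onField X)) x :=
  MDifferentiableAt.clm_bundle_apply (J.contMDiff'.contMDiffAt.mdifferentiableAt (by simp)) hX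

theorem onField_add (X Y : ∀ x : M, TangentSpace 𝓘(ℝ, E) x) :
    J.onField (X + Y) = J.onField X + J.onField Y := by
  funext x; simp [onField]

theorem onField_smul (f : M → ℝ) (X : ∀ x : M, TangentSpace 𝓘(ℝ, E) x) :
    J.onField (f • X) = f • J.onField X := by
  funext x; simp [onField]

theorem nijenhuisField_swap (X Y : ∀ x : M, TangentSpace 𝓘(ℝ, E) x) (x : M) :
    J.nijenhuisField X Y x = - J.nijenhuisField Y X x := by
  simp only [nijenhuisField]
  rw [VectorField.mlieBracket_swap_apply (V := J.onField X) (W := J.onField Y),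
    VectorField.mlieBracket_swap_apply (V := X) (W := J.onField Y),
    VectorField.mlieBracket_swap_apply (V := J.onField X) (W := Y),
    VectorField.mlieBracket_swap_apply (V := X) (W := Y)]
  simp only [map_neg]
  abel

variable [FiniteDimensional ℝ E]

theorem nijenhuisField_tensorial (x : M) (Y : ∀ x : M, TangentSpace 𝓘(ℝ, E) x) :
    TensorialAt 𝓘(ℝ, E) E (fun X ↦ J.nijenhuisField X Y x) x where
  smul {f X} hf hX := by
    have : CompleteSpace E := FiniteDimensional.complete ℝ E
    have h := J.mdifferentiableAt_onField hX
    simp only [nijenhuisField, onField_smul]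
    rw [VectorField.mlieBracket_smul_left hf hX, VectorField.mlieBracket_smul_left hf h,
      VectorField.mlieBracket_smul_left hf hX, VectorField.mlieBracket_smul_left hf h]
    simp only [map_add, map_smul, onField, J.sq']
    module
  add {X X'} hX hX' := by
    have : CompleteSpace E := FiniteDimensional.complete ℝ E
    have h := J.mdifferentiableAt_onField hX
    have h' := J.mdifferentiableAt_onField hX'
    simp only [nijenhuisField, onField_add]
    rw [VectorField.mlieBracket_add_left hX hX', VectorField.mlieBracket_add_left h h',
      VectorField.mlieBracket_add_left hX hX', VectorField.mlieBracket_add_left h h']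
    simp only [map_add]
    abel

theorem nijenhuisField_tensorial' (x : M) (X : ∀ x : M, TangentSpace 𝓘(ℝ, E) x) :
    TensorialAt 𝓘(ℝ, E) E (fun Y ↦ J.nijenhuisField X Y x) x where
  smul {f Y} hf hY := by
    rw [J.nijenhuisField_swap X (f • Y), J.nijenhuisField_swap X Y,
      (J.nijenhuisField_tensorial x X).smul hf hY, smul_neg]
  add {Y Y'} hY hY' := by
    rw [J.nijenhuisField_swap X (Y + Y'), J.nijenhuisField_swap X Y, J.nijenhuisField_swap X Y',
      (J.nijenhuisField_tensorial x X).add hY hY', neg_add]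

/-- The Nijenhuis tensor `N_J` (with values `N_J(X, Y)` at `x` given by `nijenhuisField`
for all vector fields `X`, `Y` that are differentiable at `x`). -/
noncomputable def nijenhuis (x : M) :
    TangentSpace 𝓘(ℝ, E) x →L[ℝ] TangentSpace 𝓘(ℝ, E) x →L[ℝ] TangentSpace 𝓘(ℝ, E) x :=
  TensorialAt.mkHom₂ (fun X Y ↦ J.nijenhuisField X Y x) x
    (fun Y _ ↦ J.nijenhuisField_tensorial x Y) (fun X _ ↦ J.nijenhuisField_tensorial' x X)

/-- The tensor `J N_J`, `(X, Y) ↦ J (N_J(X, Y))`. -/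
noncomputable def compNijenhuis : BilinearTensor E M := fun x ↦
  IsBilinearMap.toContinuousBilinearMap (𝕜 := ℝ) (f := fun X Y ↦ J x (J.nijenhuis x X Y))
    ⟨by intros; simp, by intros; simp, by intros; simp, by intros; simp⟩

end AlmostComplexStructure

/-! ## Connections on an almost complex manifold -/

namespace Connection

variable {E : Type*} [NormedAddCommGroup E] [NormedSpace ℝ E] [FiniteDimensional ℝ E]
  {M : Type*} [TopologicalSpace M] [ChartedSpace E M] [IsManifold 𝓘(ℝ, E) ∞ M]

/-- The torsion tensor `T(X, Y) = ∇_X Y - ∇_Y X - [X, Y]`. -/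
noncomputable def torsionTensor (cov : Connection E M) : BilinearTensor E M :=
  have : CompleteSpace E := FiniteDimensional.complete ℝ E
  CovariantDerivative.torsion cov

/-- The connection `∇ - T/2`. -/
noncomputable def symmetrization (cov : Connection E M) : Connection E M :=
  CovariantDerivative.addOneForm cov fun x ↦
    IsBilinearMap.toContinuousBilinearMap (𝕜 := ℝ)
      (f := fun Y X ↦ -((1 / 2 : ℝ) • torsionTensor cov x X Y))
      ⟨by intros; simp only [map_add]; module,
        by intros; simp only [map_smul]; module,
        by intros; simp only [map_add, add_apply]; module,
        by intros; simp only [map_smul, smul_apply]; module⟩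

/-- `∇_X (JY) - J ∇_X Y` at `x`. -/
noncomputable def nablaField (cov : Connection E M) (J : AlmostComplexStructure E M)
    (X Y : ∀ x : M, TangentSpace 𝓘(ℝ, E) x) (x : M) : TangentSpace 𝓘(ℝ, E) x :=
  cov.toFun (J.onField Y) x (X x) - J x (cov.toFun Y x (X x))

/-- The tensor `∇J`, with `(∇J)(X, Y) = ∇_X (JY) - J ∇_X Y`. -/
noncomputable def nabla (cov : Connection E M) (J : AlmostComplexStructure E M) :
    BilinearTensor E M := fun x ↦
  TensorialAt.mkHom₂ (I := 𝓘(ℝ, E)) (F := E) (F' := E) (fun X Y ↦ nablaField cov J X Y x) x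
    (fun Y _ ↦
      { smul := fun {f X} _ _ ↦ by simp [nablaField, smul_sub]
        add := fun {X X'} _ _ ↦ by simp only [nablaField, Pi.add_apply, map_add]; abel })
    (fun X _ ↦
      { smul := fun {f Y} hf hY ↦ by
          simp only [nablaField, J.onField_smul]
          rw [cov.isCovariantDerivativeOnUniv.leibniz (J.mdifferentiableAt_onField hY) hf,
            cov.isCovariantDerivativeOnUniv.leibniz hY hf]
          simp only [add_apply, smul_apply, ContinuousLinearMap.smulRight_apply, map_add, map_smul,
            AlmostComplexStructure.onField]
          module
        add := fun {Y Y'} hY hY' ↦ by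
          simp only [nablaField, J.onField_add]
          rw [cov.isCovariantDerivativeOnUniv.add (J.mdifferentiableAt_onField hY)
            (J.mdifferentiableAt_onField hY'), cov.isCovariantDerivativeOnUniv.add hY hY']
          simp only [add_apply, map_add]
          abel })

/-- The tensor `[∇J](X, Y) = -(∇J)(X, Y) + (∇J)(Y, X)`. -/
noncomputable def bracketNabla (cov : Connection E M) (J : AlmostComplexStructure E M) :
    BilinearTensor E M := fun x ↦
  IsBilinearMap.toContinuousBilinearMap (𝕜 := ℝ)
    (f := fun X Y ↦ -(nabla cov J x X Y) + nabla cov J x Y X)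
    ⟨by intros; simp; abel, by intros; simp, by intros; simp; abel, by intros; simp⟩

/-- The tensor `S(X, Y) = -(∇J)(X, Y) + (∇J)(Y, X) + T(JX, Y) - J T(X, Y)`. -/
noncomputable def tensorS (cov : Connection E M) (J : AlmostComplexStructure E M) :
    BilinearTensor E M := fun x ↦
  IsBilinearMap.toContinuousBilinearMap (𝕜 := ℝ)
    (f := fun X Y ↦ -(nabla cov J x X Y) + nabla cov J x Y X
      + torsionTensor cov x (J x X) Y - J x (torsionTensor cov x X Y))
    ⟨by intros; simp; abel, by intros; simp [smul_sub], by intros; simp; abel,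
      by intros; simp [smul_sub]⟩

/-- `∇` is almost complex: `∇_X (JY) = J ∇_X Y` for all `X, Y ∈ Γ(TM)`. -/
def IsAlmostComplex (cov : Connection E M) (J : AlmostComplexStructure E M) : Prop :=
  ∀ X Y : ∀ x : M, TangentSpace 𝓘(ℝ, E) x, IsSmoothVectorField X → IsSmoothVectorField Y →
    ∀ x : M, cov.toFun (J.onField Y) x (X x) = J x (cov.toFun Y x (X x))

/-- `∇` is minimal: its torsion is `N_J / 4`. -/
def IsMinimal (cov : Connection E M) (J : AlmostComplexStructure E M) : Prop :=
  ∀ x : M, torsionTensor cov x = (1 / 4 : ℝ) • J.nijenhuis x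

end Connection

/-! ## The geometry of the cotangent bundle -/

namespace CotangentBundle

variable {E : Type*} [NormedAddCommGroup E] [NormedSpace ℝ E]
  {M : Type*} [TopologicalSpace M] [ChartedSpace E M] [IsManifold 𝓘(ℝ, E) ∞ M]

/-- The differential `d_ξ π` of the projection `π : T^*M → M`. -/
noncomputable def dproj (ξ : CotangentBundle E M) :
    ξ.Tangent →L[ℝ] TangentSpace 𝓘(ℝ, E) ξ.proj :=
  mfderiv (cotangentModel E) 𝓘(ℝ, E) (fun ζ : CotangentBundle E M ↦ ζ.proj) ξ

theorem extChart_fst (ξ ζ : CotangentBundle E M) :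
    (extChartAt (cotangentModel E) ξ ζ).1 = extChartAt 𝓘(ℝ, E) ξ.proj ζ.proj := rfl

theorem extChart_snd (ξ ζ : CotangentBundle E M) :
    (extChartAt (cotangentModel E) ξ ζ).2 =
    (ζ.2 : TangentSpace 𝓘(ℝ,E) ζ.proj →L[ℝ] ℝ).comp ((trivializationAt E (TangentSpace 𝓘(ℝ, E)) ξ.proj).symmL ℝ ζ.proj) := by
  change (trivializationAt (E →L[ℝ] ℝ) (CotangentSpace E (M := M)) ξ.proj ζ).2 = _
  rw [hom_trivializationAt_apply]
  ext v
  simp [ContinuousLinearMap.inCoordinates]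

theorem dproj_apply (ξ : CotangentBundle E M) (V : ξ.Tangent) :
    dproj ξ V = V.1 := by
  rw [dproj, MDifferentiableAt.mfderiv (mdifferentiableAt_proj _)]
  have : writtenInExtChartAt (cotangentModel E) 𝓘(ℝ, E) ξ (fun ζ : CotangentBundle E M ↦ ζ.proj)
     =ᶠ[𝓝 (extChartAt (cotangentModel E) ξ ξ)] Prod.fst := by
    filter_upwards [extChartAt_target_mem_nhds (I := cotangentModel E) ξ] with y hy
    simp only [writtenInExtChartAt, Function.comp]
    rw [← extChart_fst, PartialEquiv.right_inv _ hy]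
  rw [ModelWithCorners.range_eq_univ, fderivWithin_univ, this.fderiv_eq, fderiv_fst]
  rfl

/-- The velocity at `t = 0` of the curve `t ↦ ξ + t η` in the fibre of `T^*M` through `ξ`. -/
noncomputable def fibreVelocity (ξ : CotangentBundle E M) (η : CotangentSpace E ξ.proj) :
    ξ.Tangent :=
  mfderiv 𝓘(ℝ, ℝ) (cotangentModel E)
    (fun t : ℝ ↦ (⟨ξ.proj, ξ.2 + t • η⟩ : CotangentBundle E M)) 0 (1 : ℝ)

theorem symmL_self (x : M) (v : E) : (trivializationAt E (TangentSpace 𝓘(ℝ, E)) x).symmL ℝ x v = v := by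
  rw [TangentBundle.symmL_trivializationAt_eq_core (by simp)]
  simpa using! (tangentBundleCore 𝓘(ℝ, E) M).coordChange_self (achart E x) x (mem_chart_source E x) v


theorem fibreVelocity_eq (ξ : CotangentBundle E M) (η : CotangentSpace E ξ.proj) :
    fibreVelocity ξ η = ((0, η) : E × (E →L[ℝ] ℝ)) := by
  have key : ∀ t : ℝ, extChartAt (cotangentModel E) ξ (⟨ξ.proj, ξ.2 + t • η⟩ : CotangentBundle E M)
      = (extChartAt 𝓘(ℝ, E) ξ.proj ξ.proj, (show E →L[ℝ] ℝ from ξ.2) + t • (show E →L[ℝ] ℝ from η)) := by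
    intro t
    refine Prod.ext rfl ?_
    rw [extChart_snd]
    ext v
    change (ξ.2 + t • η) ((trivializationAt E (TangentSpace 𝓘(ℝ, E)) ξ.proj).symmL ℝ ξ.proj v) = _
    rw [symmL_self]; rfl
  have hm : MDifferentiableAt 𝓘(ℝ, ℝ) (cotangentModel E) (fun t : ℝ ↦ (⟨ξ.proj, ξ.2 + t • η⟩ : CotangentBundle E M)) 0 := by
    rw [mdifferentiableAt_totalSpace]
    refine ⟨mdifferentiableAt_const, ?_⟩
    have : (fun t : ℝ ↦ (trivializationAt (E →L[ℝ] ℝ) (CotangentSpace E (M := M)) ξ.proj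
      (⟨ξ.proj, ξ.2 + t • η⟩ : CotangentBundle E M)).2) = fun t ↦ (show E →L[ℝ] ℝ from ξ.2) + t • (show E →L[ℝ] ℝ from η) :=
      funext fun t ↦ congrArg Prod.snd (key t)
    refine MDifferentiableAt.congr_of_eventuallyEq ?_ (Filter.Eventually.of_forall fun t ↦ congrFun this t)
    exact (by fun_prop : DifferentiableAt ℝ (fun t : ℝ ↦ (show E →L[ℝ] ℝ from ξ.2) + t • (show E →L[ℝ] ℝ from η)) 0).mdifferentiableAt
  have hw : writtenInExtChartAt 𝓘(ℝ, ℝ) (cotangentModel E) (0 : ℝ)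
      (fun t : ℝ ↦ (⟨ξ.proj, ξ.2 + t • η⟩ : CotangentBundle E M)) =
      fun t ↦ (extChartAt 𝓘(ℝ, E) ξ.proj ξ.proj, (show E →L[ℝ] ℝ from ξ.2) + t • (show E →L[ℝ] ℝ from η)) :=
    funext fun t ↦ key t
  rw [fibreVelocity, MDifferentiableAt.mfderiv hm, hw, ModelWithCorners.range_eq_univ, fderivWithin_univ]
  have hd : HasFDerivAt (fun t : ℝ ↦ (extChartAt 𝓘(ℝ, E) ξ.proj ξ.proj, (show E →L[ℝ] ℝ from ξ.2) + t • (show E →L[ℝ] ℝ from η)))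
    ((0 : ℝ →L[ℝ] E).prod ((ContinuousLinearMap.id ℝ ℝ).smulRight (show E →L[ℝ] ℝ from η))) (extChartAt 𝓘(ℝ,ℝ) (0:ℝ) (0:ℝ)) :=
    (hasFDerivAt_const _ _).prodMk (((hasFDerivAt_id _).smul_const _).const_add _)
  rw [hd.fderiv]
  exact Prod.ext rfl (one_smul ℝ (show E →L[ℝ] ℝ from η))

/-- The canonical embedding of `T^*_x M` into `T_ξ T^*M` as the vertical space, `x = π(ξ)`. -/
noncomputable def verticalLift (ξ : CotangentBundle E M) :
    CotangentSpace E ξ.proj →ₗ[ℝ] ξ.Tangent where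
  toFun := fibreVelocity ξ
  map_add' η η' := by
    rw [fibreVelocity_eq, fibreVelocity_eq, fibreVelocity_eq]
    exact Prod.ext (add_zero (0 : E)).symm rfl
  map_smul' c η := by
    rw [fibreVelocity_eq, fibreVelocity_eq]
    exact Prod.ext (smul_zero (A := E) c).symm rfl

theorem verticalLift_injective (ξ : CotangentBundle E M) :
    Function.Injective (verticalLift ξ) := by
  refine (injective_iff_map_eq_zero _).2 fun η hη ↦ ?_
  have h : fibreVelocity ξ η = 0 := hη
  rw [fibreVelocity_eq] at h
  exact congrArg Prod.snd h

/-- The Liouville form `θ`, `θ_ξ = ξ ∘ d_ξ π`. -/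
noncomputable def liouville (ξ : CotangentBundle E M) : ξ.Tangent →L[ℝ] ℝ :=
  (ξ.2 : TangentSpace 𝓘(ℝ, E) ξ.proj →L[ℝ] ℝ).comp (dproj ξ)

/-- The one-form `θ(J)` on `T^*M`, `θ(J)_ξ = ξ ∘ J ∘ d_ξ π`. -/
noncomputable def liouvilleOf (J : AlmostComplexStructure E M) (ξ : CotangentBundle E M) :
    ξ.Tangent →L[ℝ] ℝ :=
  ((ξ.2 : TangentSpace 𝓘(ℝ, E) ξ.proj →L[ℝ] ℝ).comp (J ξ.proj)).comp (dproj ξ)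

/-- The canonical symplectic form `ω_st = dθ`. -/
noncomputable def symplecticForm (ξ : CotangentBundle E M) : LinearMap.BilinForm ℝ ξ.Tangent :=
  exteriorDerivative (cotangentModel E) liouville ξ

theorem proj_mem_of_mem_source {ξ ζ : CotangentBundle E M}
    (hζ : ζ ∈ (extChartAt (cotangentModel E) ξ).source) : ζ.proj ∈ (chartAt E ξ.proj).source := by
  rw [extChartAt_source, FiberBundle.chartedSpace_chartAt] at hζ
  simp only [mfld_simps] at hζ
  exact hζ.1.1

theorem liouville_chart (ξ : CotangentBundle E M) {y : E × (E →L[ℝ] ℝ)}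
    (hy : y ∈ (extChartAt (cotangentModel E) ξ).target) :
    (liouville ((extChartAt (cotangentModel E) ξ).symm y)).comp
      (mfderivWithin 𝓘(ℝ, E × (E →L[ℝ] ℝ)) (cotangentModel E)
      (extChartAt (cotangentModel E) ξ).symm (Set.range (cotangentModel E)) y)
    = y.2.comp (ContinuousLinearMap.fst ℝ E (E →L[ℝ] ℝ)) := by
  have hζ : (extChartAt (cotangentModel E) ξ).symm y ∈ (extChartAt (cotangentModel E) ξ).source :=
    PartialEquiv.map_target _ hy
  have hd : MDifferentiableAt 𝓘(ℝ, E × (E →L[ℝ] ℝ)) (cotangentModel E)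
      (extChartAt (cotangentModel E) ξ).symm y := by
    have := mdifferentiableWithinAt_extChartAt_symm (I := cotangentModel E) hy
    rwa [ModelWithCorners.range_eq_univ, mdifferentiableWithinAt_univ] at this
  have hyζ : extChartAt (cotangentModel E) ξ ((extChartAt (cotangentModel E) ξ).symm y) = y :=
    PartialEquiv.right_inv _ hy
  rw [ModelWithCorners.range_eq_univ, mfderivWithin_univ]
  have h2 := extChart_snd ξ ((extChartAt (cotangentModel E) ξ).symm y)
  rw [hyζ] at h2
  have h3 := extChart_fst ξ ((extChartAt (cotangentModel E) ξ).symm y)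
  rw [hyζ] at h3
  have hs : ((extChartAt (cotangentModel E) ξ).symm y).proj ∈ (chartAt E ξ.proj).source :=
    proj_mem_of_mem_source hζ
  have h1 : (dproj ((extChartAt (cotangentModel E) ξ).symm y)).comp
      (mfderiv 𝓘(ℝ, E × (E →L[ℝ] ℝ)) (cotangentModel E)
      (extChartAt (cotangentModel E) ξ).symm y) =
      ((trivializationAt E (TangentSpace 𝓘(ℝ, E) : M → Type _) ξ.proj).symmL ℝ
        ((extChartAt (cotangentModel E) ξ).symm y).proj).comp
        (ContinuousLinearMap.fst ℝ E (E →L[ℝ] ℝ)) := by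
    rw [dproj, ← mfderiv_comp y (mdifferentiableAt_proj _) hd, TangentBundle.symmL_trivializationAt hs, ← h3]
    rw [ModelWithCorners.range_eq_univ, mfderivWithin_univ]
    have hy1 : y.1 ∈ (extChartAt 𝓘(ℝ, E) ξ.proj).target := by
      rw [h3]; exact (extChartAt 𝓘(ℝ, E) ξ.proj).map_source (by rwa [extChartAt_source])
    have hev : (fun ζ : CotangentBundle E M ↦ ζ.proj) ∘ (extChartAt (cotangentModel E) ξ).symm
        =ᶠ[𝓝 y] (extChartAt 𝓘(ℝ, E) ξ.proj).symm ∘ Prod.fst := by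
      filter_upwards [(isOpen_extChartAt_target (I := cotangentModel E) ξ).mem_nhds hy] with z hz
      have e := extChart_fst ξ ((extChartAt (cotangentModel E) ξ).symm z)
      rw [PartialEquiv.right_inv _ hz] at e
      simp only [Function.comp]
      rw [e, PartialEquiv.left_inv]
      rw [extChartAt_source]
      exact proj_mem_of_mem_source (PartialEquiv.map_target _ hz)
    have hf : HasMFDerivAt 𝓘(ℝ, E × (E →L[ℝ] ℝ)) 𝓘(ℝ, E) Prod.fst y (ContinuousLinearMap.fst ℝ E (E →L[ℝ] ℝ)) :=
      hasFDerivAt_fst.hasMFDerivAt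
    have hsy : MDifferentiableAt 𝓘(ℝ, E) 𝓘(ℝ, E) (extChartAt 𝓘(ℝ, E) ξ.proj).symm y.1 := by
      have := mdifferentiableWithinAt_extChartAt_symm (I := 𝓘(ℝ, E)) hy1
      rwa [ModelWithCorners.range_eq_univ, mdifferentiableWithinAt_univ] at this
    rw [hev.mfderiv_eq]
    exact (HasMFDerivAt.comp y hsy.hasMFDerivAt hf).mfderiv
  exact (congrArg (fun B : (E × (E →L[ℝ] ℝ)) →L[ℝ] E ↦
      (show E →L[ℝ] ℝ from ((extChartAt (cotangentModel E) ξ).symm y).2).comp B) h1).trans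
    (congrArg (fun p : E →L[ℝ] ℝ ↦ p.comp (ContinuousLinearMap.fst ℝ E (E →L[ℝ] ℝ))) h2.symm)

set_option synthInstance.maxHeartbeats 200000 in
theorem symplecticForm_apply (ξ : CotangentBundle E M) (V W : ξ.Tangent) :
    symplecticForm ξ V W = (show E →L[ℝ] ℝ from V.2) W.1 - (show E →L[ℝ] ℝ from W.2) V.1 := by
  have hT : (fun y ↦ (liouville ((extChartAt (cotangentModel E) ξ).symm y)).comp
    (mfderivWithin 𝓘(ℝ, E × (E →L[ℝ] ℝ)) (cotangentModel E)
      (extChartAt (cotangentModel E) ξ).symm (Set.range (cotangentModel E)) y)) =ᶠ[𝓝 (extChartAt (cotangentModel E) ξ ξ)]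
      fun y ↦ y.2.comp (ContinuousLinearMap.fst ℝ E (E →L[ℝ] ℝ)) := by
    filter_upwards [extChartAt_target_mem_nhds (I := cotangentModel E) ξ] with y hy
    exact liouville_chart ξ hy
  let B : (E × (E →L[ℝ] ℝ)) →L[ℝ] ((E × (E →L[ℝ] ℝ)) →L[ℝ] ℝ) :=
    (ContinuousLinearMap.precomp ℝ (ContinuousLinearMap.fst ℝ E (E →L[ℝ] ℝ))).comp (ContinuousLinearMap.snd ℝ E (E →L[ℝ] ℝ))
  have hd : ∀ p, HasFDerivAt (fun y : E × (E →L[ℝ] ℝ) ↦ y.2.comp (ContinuousLinearMap.fst ℝ E (E →L[ℝ] ℝ)))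
     B p := by
    intro p
    change HasFDerivAt (fun y ↦ B y) B p
    exact ContinuousLinearMap.hasFDerivAt (𝕜 := ℝ) (E := E × (E →L[ℝ] ℝ))
      (F := E × (E →L[ℝ] ℝ) →L[ℝ] ℝ) B
  simp only [symplecticForm, exteriorDerivative, LinearMap.mk₂_apply, mfderiv_extChartAt_self]
  rw [ModelWithCorners.range_eq_univ, fderivWithin_univ]
  rw [ModelWithCorners.range_eq_univ] at hT
  rw [hT.fderiv_eq, (hd _).fderiv]
  rfl

theorem symplecticForm_nondegenerate (ξ : CotangentBundle E M) :
    (symplecticForm ξ).Nondegenerate := by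
  constructor
  · intro V hV
    have h : ∀ W : E × (E →L[ℝ] ℝ), (show E →L[ℝ] ℝ from V.2) W.1 - W.2 V.1 = 0 := fun W ↦
      (symplecticForm_apply ξ V W).symm.trans (hV W)
    refine Prod.ext ?_ ?_
    · change (V.1 : E) = 0
      by_contra hne
      obtain ⟨q, hq⟩ := SeparatingDual.exists_eq_one (R := ℝ) (V := E) hne
      have h2 := h (0, q)
      rw [map_zero, hq] at h2
      norm_num at h2
    · refine ContinuousLinearMap.ext fun v : E ↦ ?_
      exact (sub_zero _).symm.trans (h (v, 0))
  · intro V hV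
    have h : ∀ W : E × (E →L[ℝ] ℝ), W.2 V.1 - (show E →L[ℝ] ℝ from V.2) W.1 = 0 := fun W ↦
      (symplecticForm_apply ξ W V).symm.trans (hV W)
    refine Prod.ext ?_ ?_
    · change (V.1 : E) = 0
      by_contra hne
      obtain ⟨q, hq⟩ := SeparatingDual.exists_eq_one (R := ℝ) (V := E) hne
      have h2 := h (0, q)
      rw [map_zero, hq] at h2
      norm_num at h2
    · refine ContinuousLinearMap.ext fun v : E ↦ ?_
      exact neg_eq_zero.1 ((zero_sub _).symm.trans (h (v, 0)))

/-- The contraction `γ(R)` of a tensor `R`: the endomorphism field of `T T^*M` that maps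
`V ∈ T_ξ T^*M` to the vertical lift of the covector `Z ↦ ξ(R(d_ξ π V, Z))`. -/
noncomputable def gamma (R : BilinearTensor E M) : CotangentEndomorphism E M := fun ξ ↦
  verticalLift ξ ∘ₗ
    { toFun := fun V ↦ (ξ.2 : TangentSpace 𝓘(ℝ, E) ξ.proj →L[ℝ] ℝ).comp (R ξ.proj (dproj ξ V))
      map_add' := fun V W ↦ by rw [(dproj ξ).map_add, (R ξ.proj).map_add]; ext; simp
      map_smul' := fun c V ↦ by rw [(dproj ξ).map_smul, (R ξ.proj).map_smul]; ext; simp }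

end CotangentBundle

/-! ## The horizontal distribution of a connection -/

namespace Connection

open CotangentBundle

variable {E : Type*} [NormedAddCommGroup E] [NormedSpace ℝ E]
  {M : Type*} [TopologicalSpace M] [ChartedSpace E M] [IsManifold 𝓘(ℝ, E) ∞ M]

/-- The induced connection on `T^*M`, paired with a vector field:
`(∇_X s)(Y) = X.s(Y) - s(∇_X Y)` at `x`. -/
noncomputable def dualDerivative (cov : Connection E M)
    (s : ∀ x : M, CotangentSpace E x) (x : M) (X : TangentSpace 𝓘(ℝ, E) x)
    (Y : ∀ x : M, TangentSpace 𝓘(ℝ, E) x) : ℝ :=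
  mvfderiv 𝓘(ℝ, E) (fun x' ↦ s x' (Y x')) x X - s x (cov.toFun Y x X)

/-- The set `H_ξ` of all `d_x s(X)`, where `x = π(ξ)`, `X ∈ T_x M`, `s ∈ Γ(T^*M)`, `s(x) = ξ` and
`∇_X s = 0`. -/
def horizontalSet (cov : Connection E M) (ξ : CotangentBundle E M) : Set ξ.Tangent :=
  {V | ∃ s : ∀ x : M, CotangentSpace E x, IsSmoothCovectorField s ∧ s ξ.proj = ξ.2 ∧
    ∃ X : TangentSpace 𝓘(ℝ, E) ξ.proj,
      (∀ Y, IsSmoothVectorField Y → dualDerivative cov s ξ.proj X Y = 0) ∧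
      V = mfderiv 𝓘(ℝ, E) (cotangentModel E)
        (fun x ↦ TotalSpace.mk' (E →L[ℝ] ℝ) x (s x)) ξ.proj X}

variable (cov : Connection E M)

theorem mdiff_pair {s : ∀ x : M, CotangentSpace E x} {x : M}
    (hs : MDifferentiableAt 𝓘(ℝ, E) (cotangentModel E) (fun x ↦ TotalSpace.mk' (E →L[ℝ] ℝ) x (s x)) x) {Y : ∀ x : M, TangentSpace 𝓘(ℝ, E) x} (hY : MDiffAt (T% Y) x) :
    MDiffAt (fun x' ↦ s x' (Y x')) x := by
  have := MDifferentiableAt.clm_bundle_apply (E₂ := fun _ : M ↦ ℝ) hs hY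
  rw [mdifferentiableAt_section] at this
  exact this

theorem dualDerivative_tensorial {s : ∀ x : M, CotangentSpace E x} {x : M}
    (hs : MDifferentiableAt 𝓘(ℝ, E) (cotangentModel E) (fun x ↦ TotalSpace.mk' (E →L[ℝ] ℝ) x (s x)) x) (X : TangentSpace 𝓘(ℝ, E) x) :
    TensorialAt 𝓘(ℝ, E) E (dualDerivative cov s x X) x where
  smul {f Y} hf hY := by
    have h := mdiff_pair hs hY
    have e : (fun x' ↦ s x' ((f • Y) x')) = f • fun x' ↦ s x' (Y x') := by
      funext x'; simp
    rw [dualDerivative, e, mvfderiv_smul hf h, cov.isCovariantDerivativeOnUniv.leibniz hY hf]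
    simp [dualDerivative]
    ring
  add {Y Y'} hY hY' := by
    have e : (fun x' ↦ s x' ((Y + Y') x')) = (fun x' ↦ s x' (Y x')) + fun x' ↦ s x' (Y' x') := by
      funext x'; simp
    rw [dualDerivative, e, mvfderiv_add (mdiff_pair hs hY) (mdiff_pair hs hY'),
      cov.isCovariantDerivativeOnUniv.add hY hY']
    simp [dualDerivative]
    ring

theorem exists_global {F : Type*} [NormedAddCommGroup F] [NormedSpace ℝ F]
  {V : M → Type*} [TopologicalSpace (TotalSpace F V)]
  [∀ x, AddCommGroup (V x)] [∀ x, Module ℝ (V x)]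
  [∀ x : M, TopologicalSpace (V x)]
  [FiberBundle F V] [VectorBundle ℝ F V] [ContMDiffVectorBundle ∞ F V 𝓘(ℝ, E)] [FiniteDimensional ℝ E]
  [T2Space M] (x : M) (v : V x) : ∃ σ : ∀ x, V x, ContMDiff 𝓘(ℝ, E) (𝓘(ℝ, E).prod 𝓘(ℝ, F)) ∞ (fun x ↦ TotalSpace.mk' F x (σ x))
    ∧ ∀ᶠ x' in 𝓝 x, σ x' = FiberBundle.extend F v x' := by
  obtain ⟨f, -, hf⟩ := (SmoothBumpFunction.nhds_basis_tsupport (I := 𝓘(ℝ, E)) x).mem_iff.1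
    ((trivializationAt F V x).open_baseSet.mem_nhds (FiberBundle.mem_baseSet_trivializationAt' x))
  refine ⟨fun x' ↦ f x' • FiberBundle.extend F v x', ?_, ?_⟩
  · have h : ContMDiffOn 𝓘(ℝ, E) (𝓘(ℝ, E).prod 𝓘(ℝ, F)) ∞ (fun x' ↦ TotalSpace.mk' F x' (FiberBundle.extend F v x')) (trivializationAt F V x).baseSet := by
      rw [(trivializationAt F V x).contMDiffOn_section_baseSet_iff]
      have : ContMDiffOn 𝓘(ℝ, E) 𝓘(ℝ, F) ∞ (fun _ : M ↦ (trivializationAt F V x ⟨x, v⟩).2) (trivializationAt F V x).baseSet :=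
        contMDiffOn_const
      exact this.congr (fun x hx ↦ by simp [FiberBundle.extend, hx])
    exact ContMDiffOn.smul_section_of_tsupport f.contMDiff.contMDiffOn (trivializationAt F V x).open_baseSet hf h
  · filter_upwards [f.eventuallyEq_one] with x' hx'
    simp [hx']

theorem exists_coord [FiniteDimensional ℝ E] [T2Space M] (x : M) (X : TangentSpace 𝓘(ℝ, E) x) (hX : X ≠ 0) :
    ∃ b : M → ℝ, ContMDiff 𝓘(ℝ, E) 𝓘(ℝ, ℝ) ∞ b ∧ b x = 0 ∧ mvfderiv 𝓘(ℝ, E) b x X = 1 := by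
  obtain ⟨ℓ, hℓ⟩ : ∃ ℓ : E →L[ℝ] ℝ, ℓ X = 1 := SeparatingDual.exists_eq_one (R := ℝ) (V := E) hX
  let f : SmoothBumpFunction 𝓘(ℝ, E) x := Classical.arbitrary _
  let g : M → ℝ := fun x' ↦ ℓ (extChartAt 𝓘(ℝ, E) x x' - extChartAt 𝓘(ℝ, E) x x)
  have hg : ContMDiffOn 𝓘(ℝ, E) 𝓘(ℝ, ℝ) ∞ g (chartAt E x).source :=
    ℓ.contMDiff.comp_contMDiffOn ((contMDiffOn_extChartAt (n := ∞)).sub contMDiffOn_const)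
  refine ⟨fun x' ↦ f x' • g x', f.contMDiff_smul hg, by simp [g], ?_⟩
  have hgx : HasMFDerivAt 𝓘(ℝ, E) 𝓘(ℝ, ℝ) g x ℓ := by
    have h1 : HasMFDerivAt 𝓘(ℝ, E) 𝓘(ℝ, E) (extChartAt 𝓘(ℝ, E) x) x (ContinuousLinearMap.id ℝ E) := by
      have := (mdifferentiableAt_extChartAt (I := 𝓘(ℝ, E)) (mem_chart_source E x)).hasMFDerivAt
      rwa [mfderiv_extChartAt_self] at this
    have h2 : HasFDerivAt (fun y ↦ ℓ (y - extChartAt 𝓘(ℝ, E) x x)) ℓ (extChartAt 𝓘(ℝ, E) x x) :=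
      ℓ.hasFDerivAt.comp _ ((hasFDerivAt_id _).sub_const _)
    exact HasMFDerivAt.comp x h2.hasMFDerivAt h1
  have he : (fun x' ↦ f x' • g x') =ᶠ[𝓝 x] g := by
    filter_upwards [f.eventuallyEq_one] with x' hx'
    simp [hx']
  rw [mvfderiv, he.mfderiv_eq, hgx.mfderiv]
  exact hℓ

theorem extend_eq (x : M) (Z : TangentSpace 𝓘(ℝ, E) x) {x' : M}
    (hx' : x' ∈ (trivializationAt E (TangentSpace 𝓘(ℝ, E)) x).baseSet) : FiberBundle.extend E Z x' =
    (trivializationAt E (TangentSpace 𝓘(ℝ, E)) x).symmL ℝ x' Z := by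
  have : (trivializationAt E (TangentSpace 𝓘(ℝ, E)) x ⟨x, Z⟩).2 = Z := by
    rw [← Trivialization.continuousLinearMapAt_apply_of_mem (R := ℝ) _
      (FiberBundle.mem_baseSet_trivializationAt' x),
      TangentBundle.continuousLinearMapAt_trivializationAt (mem_chart_source E x),
      mfderiv_extChartAt_self]
    rfl
  rw [FiberBundle.extend, this]
  exact (Trivialization.symmL_apply _ hx' _).symm

theorem mfderiv_section {s : ∀ x : M, CotangentSpace E x} {x : M}
    (hs : MDifferentiableAt 𝓘(ℝ, E) (cotangentModel E) (fun x ↦ TotalSpace.mk' (E →L[ℝ] ℝ) x (s x)) x)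
    (X : TangentSpace 𝓘(ℝ, E) x) :
    ∃ q : E →L[ℝ] ℝ, (mfderiv 𝓘(ℝ, E) (cotangentModel E) (fun x ↦ TotalSpace.mk' (E →L[ℝ] ℝ) x (s x)) x X
      : E × (E →L[ℝ] ℝ)) = (X, q) ∧
     ∀ Z : TangentSpace 𝓘(ℝ, E) x, q Z = mvfderiv 𝓘(ℝ, E) (fun x' ↦ s x' (FiberBundle.extend E Z x')) x X := by
  set f : M → CotangentBundle E M := fun x ↦ TotalSpace.mk' (E →L[ℝ] ℝ) x (s x) with hf
  have hd := hs.hasMFDerivAt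
  have hφ : HasMFDerivAt (cotangentModel E) 𝓘(ℝ, E × (E →L[ℝ] ℝ)) (extChartAt (cotangentModel E) (f x)) (f x)
      (ContinuousLinearMap.id ℝ (E × (E →L[ℝ] ℝ))) := by
    have := (mdifferentiableAt_extChartAt (I := cotangentModel E) (mem_chart_source (ModelProd E (E →L[ℝ] ℝ)) (f x))).hasMFDerivAt
    rwa [mfderiv_extChartAt_self] at this
  have hc := HasMFDerivAt.comp x hφ hd
  refine ⟨(mfderiv 𝓘(ℝ, E) (cotangentModel E) f x X : E × (E →L[ℝ] ℝ)).2, Prod.ext ?_ rfl, ?_⟩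
  · change _ = X
    rw [← dproj_apply (f x)]
    have hp : HasMFDerivAt (cotangentModel E) 𝓘(ℝ, E) (fun ζ : CotangentBundle E M ↦ ζ.proj) (f x)
        (dproj (f x)) := (mdifferentiableAt_proj _).hasMFDerivAt
    have h1 := hasMFDerivAt_unique (HasMFDerivAt.comp x hp hd) (hasMFDerivAt_id x)
    exact congrArg (fun B : E →L[ℝ] E ↦ B X) h1
  · intro Z
    let ev : (E × (E →L[ℝ] ℝ)) →L[ℝ] ℝ := (ContinuousLinearMap.apply ℝ ℝ (show E from Z)).comp (ContinuousLinearMap.snd ℝ E (E →L[ℝ] ℝ))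
    have hev : HasMFDerivAt 𝓘(ℝ, E × (E →L[ℝ] ℝ)) 𝓘(ℝ, ℝ) ev (extChartAt (cotangentModel E) (f x) (f x)) ev :=
      (ContinuousLinearMap.hasFDerivAt (𝕜 := ℝ) (E := E × (E →L[ℝ] ℝ)) (F := ℝ) ev).hasMFDerivAt
    have hcc := HasMFDerivAt.comp x hev hc
    have heq : (ev ∘ (extChartAt (cotangentModel E) (f x)) ∘ f) =ᶠ[𝓝 x] fun x' ↦ s x' (FiberBundle.extend E Z x') := by
      filter_upwards [(trivializationAt E (TangentSpace 𝓘(ℝ, E)) x).open_baseSet.mem_nhds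
        (FiberBundle.mem_baseSet_trivializationAt' x)] with x' hx'
      change (extChartAt (cotangentModel E) (f x) (f x')).2 Z = _
      rw [extChart_snd, extend_eq x Z hx']
      rfl
    rw [mvfderiv, ← heq.mfderiv_eq, hcc.mfderiv]
    rfl

theorem extend_pair (x : M) (η : CotangentSpace E x) (Z : TangentSpace 𝓘(ℝ, E) x) {x' : M}
    (hx' : x' ∈ (trivializationAt E (TangentSpace 𝓘(ℝ, E)) x).baseSet) :
    (FiberBundle.extend (E →L[ℝ] ℝ) η x' : CotangentSpace E x') (FiberBundle.extend E Z x') = η Z := by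
  have hb : x' ∈ (trivializationAt (E →L[ℝ] ℝ) (CotangentSpace E (M := M)) x).baseSet := ⟨hx', trivial⟩
  have e1 : (trivializationAt (E →L[ℝ] ℝ) (CotangentSpace E (M := M)) x ⟨x', FiberBundle.extend (E →L[ℝ] ℝ) η x'⟩).2
     = (trivializationAt (E →L[ℝ] ℝ) (CotangentSpace E (M := M)) x ⟨x, η⟩).2 := by
    rw [FiberBundle.extend]
    rw [Trivialization.apply_mk_symm _ hb]
  have k1 := extChart_snd (⟨x, η⟩ : CotangentBundle E M) ⟨x', FiberBundle.extend (E →L[ℝ] ℝ) η x'⟩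
  have k2 := extChart_snd (⟨x, η⟩ : CotangentBundle E M) ⟨x, η⟩
  have k3 := k1.symm.trans ((show _ = _ from e1).trans k2)
  have k4 := congrArg (fun p : E →L[ℝ] ℝ ↦ p Z) k3
  rw [extend_eq x Z hx']
  refine k4.trans ?_
  change η ((trivializationAt E (TangentSpace 𝓘(ℝ, E)) x).symmL ℝ x Z) = η Z
  exact congrArg (fun z : E ↦ (show E →L[ℝ] ℝ from η) z) (symmL_self (E := E) x Z)

variable [FiniteDimensional ℝ E] [T2Space M]

theorem exists_section (x : M) (η p : CotangentSpace E x) (X : TangentSpace 𝓘(ℝ, E) x) (h : X = 0 → p = 0) :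
    ∃ s : ∀ x : M, CotangentSpace E x, IsSmoothCovectorField s ∧ s x = η ∧
      ∀ Z : TangentSpace 𝓘(ℝ, E) x, mvfderiv 𝓘(ℝ, E) (fun x' ↦ s x' (FiberBundle.extend E Z x')) x X = p Z := by
  obtain ⟨σ, hσ, hσe⟩ := exists_global (E := E) (F := E →L[ℝ] ℝ) (V := CotangentSpace E (M := M)) x η
  obtain ⟨τ, hτ, hτe⟩ := exists_global (E := E) (F := E →L[ℝ] ℝ) (V := CotangentSpace E (M := M)) x p
  obtain ⟨b, hb, hb0, hbX⟩ : ∃ b : M → ℝ, ContMDiff 𝓘(ℝ, E) 𝓘(ℝ, ℝ) ∞ b ∧ b x = 0 ∧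
      ∀ Z : TangentSpace 𝓘(ℝ, E) x, mvfderiv 𝓘(ℝ, E) b x X * p Z = p Z := by
    by_cases hV : X = 0
    · refine ⟨fun _ ↦ 0, contMDiff_const, rfl, fun Z ↦ ?_⟩
      rw [h hV]; simp
    · obtain ⟨b, h1, h2, h3⟩ := exists_coord x X hV
      refine ⟨b, h1, h2, fun Z ↦ ?_⟩
      rw [h3, one_mul]
  refine ⟨σ + b • τ, hσ.add_section (hb.smul_section hτ), ?_, fun Z ↦ ?_⟩
  · simp [hb0, hσe.self_of_nhds]
  · have he : (fun x' ↦ (σ + b • τ) x' (FiberBundle.extend E Z x')) =ᶠ[𝓝 x]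
        ((fun r : ℝ ↦ η Z + r * p Z) ∘ b) := by
      filter_upwards [(trivializationAt E (TangentSpace 𝓘(ℝ, E)) x).open_baseSet.mem_nhds
        (FiberBundle.mem_baseSet_trivializationAt' x), hσe, hτe] with x' hx' h1 h2
      simp only [Pi.add_apply, Pi.smul_apply', h1, h2, add_apply, smul_apply, smul_eq_mul, Function.comp]
      rw [extend_pair _ _ _ hx', extend_pair _ _ _ hx']
    have hm : HasMFDerivAt 𝓘(ℝ, E) 𝓘(ℝ, ℝ) b x (mfderiv 𝓘(ℝ, E) 𝓘(ℝ, ℝ) b x) :=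
      (hb.contMDiffAt.mdifferentiableAt (by simp)).hasMFDerivAt
    have hl : HasFDerivAt (fun r : ℝ ↦ η Z + r * p Z)
        ((ContinuousLinearMap.id ℝ ℝ).smulRight (p Z)) (b x) :=
      ((hasFDerivAt_id _).mul_const' _).const_add _
    rw [mvfderiv, he.mfderiv_eq, (HasMFDerivAt.comp x hl.hasMFDerivAt hm).mfderiv]
    exact hbX Z

theorem mem_horizontalSet (ξ : CotangentBundle E M) (X : TangentSpace 𝓘(ℝ, E) ξ.proj) (p : CotangentSpace E ξ.proj) :
   ((X, p) : E × (E →L[ℝ] ℝ)) ∈ horizontalSet cov ξ ↔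
    ∀ Z : TangentSpace 𝓘(ℝ, E) ξ.proj, p Z = ξ.2 (cov.toFun (FiberBundle.extend E Z) ξ.proj X) := by
  constructor
  · rintro ⟨s, hs, hsx, X', hX, he⟩ Z
    have hs' := hs.contMDiffAt.mdifferentiableAt (x := ξ.proj) (by simp)
    obtain ⟨q, hq, hqZ⟩ := mfderiv_section hs' X'
    obtain ⟨Y, hY, hYe⟩ := exists_global (E := E) (F := E) (V := (TangentSpace 𝓘(ℝ, E) : M → Type _)) ξ.proj Z
    have h1 := (dualDerivative_tensorial cov hs' X').pointwise (hY.contMDiffAt.mdifferentiableAt (by simp))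
      (FiberBundle.mdifferentiableAt_extend 𝓘(ℝ, E) E Z) hYe.self_of_nhds
    rw [hX Y hY] at h1
    have h6 := he.trans hq
    obtain rfl : X = X' := congrArg Prod.fst h6
    obtain rfl : p = q := congrArg Prod.snd h6
    refine (hqZ Z).trans ?_
    rw [← hsx]
    exact (sub_eq_zero.1 h1.symm)
  · intro h
    obtain ⟨s, hs, hsx, hsp⟩ := exists_section ξ.proj ξ.2 p X (fun hX ↦ by
      ext Z
      rw [h Z, hX, map_zero, map_zero]; rfl)
    have hs' := hs.contMDiffAt.mdifferentiableAt (x := ξ.proj) (by simp)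
    obtain ⟨q, hq, hqZ⟩ := mfderiv_section hs' X
    have hqV : q = p := ContinuousLinearMap.ext fun (Z : TangentSpace 𝓘(ℝ, E) ξ.proj) ↦ (hqZ Z).trans (hsp Z)
    refine ⟨s, hs, hsx, X, fun Y hY ↦ ?_, ?_⟩
    · have h5 := (dualDerivative_tensorial cov hs' X).pointwise (hY.contMDiffAt.mdifferentiableAt (by simp))
        (FiberBundle.mdifferentiableAt_extend 𝓘(ℝ, E) E (Y ξ.proj)) (by simp)
      rw [h5]
      simp only [dualDerivative]
      rw [hsp, h, hsx, sub_self]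
    · exact (hq.trans (congrArg _ hqV)).symm

/-- The covectors `Z ↦ ξ(∇_X Z)`, as a linear function of `X`, in the preferred chart. -/
theorem exists_horizontal (ξ : CotangentBundle E M) (X : TangentSpace 𝓘(ℝ, E) ξ.proj) :
    ∃ p : CotangentSpace E ξ.proj, ∀ Z : TangentSpace 𝓘(ℝ, E) ξ.proj,
      p Z = ξ.2 (cov.toFun (FiberBundle.extend E Z) ξ.proj X) := by
  obtain ⟨s, hs, hsx, hsp⟩ := exists_section ξ.proj ξ.2 0 X (fun _ ↦ rfl)
  have hs' := hs.contMDiffAt.mdifferentiableAt (x := ξ.proj) (by simp)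
  refine ⟨-(TensorialAt.mkHom (dualDerivative cov s ξ.proj X) ξ.proj
    (dualDerivative_tensorial cov hs' X)), fun Z ↦ ?_⟩
  rw [neg_apply, TensorialAt.mkHom_apply_eq_extend, dualDerivative, hsp, hsx]
  simp

/-- The horizontal distribution `H^∇`. -/
def horizontalSpace (ξ : CotangentBundle E M) : Submodule ℝ ξ.Tangent where
  carrier := horizontalSet cov ξ
  zero_mem' := (mem_horizontalSet cov ξ 0 0).2 fun Z ↦ by simp
  add_mem' {V W} hV hW := (mem_horizontalSet cov ξ (V.1 + W.1) (V.2 + W.2)).2 fun Z ↦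
    (congrArg₂ (· + ·) ((mem_horizontalSet cov ξ V.1 V.2).1 hV Z)
      ((mem_horizontalSet cov ξ W.1 W.2).1 hW Z)).trans
      (((ξ.2 : TangentSpace 𝓘(ℝ, E) ξ.proj →L[ℝ] ℝ).comp
        (cov.toFun (FiberBundle.extend E Z) ξ.proj)).map_add V.1 W.1).symm
  smul_mem' c V hV := (mem_horizontalSet cov ξ (c • V.1) (c • V.2)).2 fun Z ↦
    (congrArg (c • ·) ((mem_horizontalSet cov ξ V.1 V.2).1 hV Z)).trans
      (((ξ.2 : TangentSpace 𝓘(ℝ, E) ξ.proj →L[ℝ] ℝ).comp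
        (cov.toFun (FiberBundle.extend E Z) ξ.proj)).map_smul c V.1).symm

theorem bijective_dproj_horizontal (ξ : CotangentBundle E M) :
    Function.Bijective ((dproj ξ).toLinearMap ∘ₗ (horizontalSpace cov ξ).subtype) := by
  constructor
  · rintro ⟨V, hV⟩ ⟨W, hW⟩ h
    have h1 : V.1 = W.1 := by
      rw [← dproj_apply, ← dproj_apply]; exact h
    refine Subtype.ext (Prod.ext h1 ?_)
    refine ContinuousLinearMap.ext fun Z ↦ ?_
    refine ((mem_horizontalSet cov ξ V.1 V.2).1 hV Z).trans ?_
    rw [h1]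
    exact ((mem_horizontalSet cov ξ W.1 W.2).1 hW Z).symm
  · intro X
    obtain ⟨p, hp⟩ := exists_horizontal cov ξ X
    exact ⟨⟨((X, p) : E × (E →L[ℝ] ℝ)), (mem_horizontalSet cov ξ X p).2 hp⟩, dproj_apply ξ _⟩

theorem isCompl_vertical_horizontal (ξ : CotangentBundle E M) :
    IsCompl (LinearMap.range (verticalLift ξ)) (horizontalSpace cov ξ) := by
  have hd : ∀ η, dproj ξ (verticalLift ξ η) = 0 := fun η ↦ by
    rw [dproj_apply]
    exact congrArg Prod.fst (fibreVelocity_eq ξ η)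
  constructor
  · rw [Submodule.disjoint_def]
    rintro _ ⟨η, rfl⟩ hH
    have := (bijective_dproj_horizontal cov ξ).1 (a₁ := ⟨_, hH⟩) (a₂ := 0)
      ((hd η).trans (LinearMap.map_zero _).symm)
    exact congrArg Subtype.val this
  · rw [codisjoint_iff, Submodule.eq_top_iff']
    intro V
    obtain ⟨W, hW⟩ := (bijective_dproj_horizontal cov ξ).2 (dproj ξ V)
    have hW1 : dproj ξ W.1 = dproj ξ V := hW
    rw [dproj_apply, dproj_apply] at hW1
    refine Submodule.mem_sup.2 ⟨V - W.1, ⟨V.2 - W.1.2, ?_⟩, W.1, W.2, sub_add_cancel _ _⟩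
    refine (fibreVelocity_eq ξ _).trans (Prod.ext ?_ rfl)
    exact (sub_eq_zero.2 hW1.symm).symm

/-- The inverse of the isomorphism `d_ξ π : H^∇_ξ → T_x M`, with values in `T_ξ T^*M`. -/
noncomputable def horizontalLift (ξ : CotangentBundle E M) :
    TangentSpace 𝓘(ℝ, E) ξ.proj →ₗ[ℝ] ξ.Tangent :=
  (horizontalSpace cov ξ).subtype ∘ₗ
    (LinearEquiv.ofBijective _ (bijective_dproj_horizontal cov ξ)).symm.toLinearMap

/-- The projection `v^∇ : T_ξ T^*M → T^*_x M` onto the vertical space, parallel to `H^∇_ξ`. -/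
noncomputable def verticalProjection (ξ : CotangentBundle E M) :
    ξ.Tangent →ₗ[ℝ] CotangentSpace E ξ.proj :=
  LinearMap.linearProjOfIsCompl (horizontalSpace cov ξ) (verticalLift ξ)
    (verticalLift_injective ξ) (isCompl_vertical_horizontal cov ξ)

end Connection

/-! ## The lifts of an almost complex structure to the cotangent bundle -/

namespace AlmostComplexStructure

open CotangentBundle Connection

variable {E : Type*} [NormedAddCommGroup E] [NormedSpace ℝ E] [FiniteDimensional ℝ E]
  {M : Type*} [TopologicalSpace M] [ChartedSpace E M] [IsManifold 𝓘(ℝ, E) ∞ M]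
  (J : AlmostComplexStructure E M)

/-- The endomorphism field `J^c`, determined by `d(θ(J)) = ω_st(J^c ., .)`. -/
noncomputable def completeLift : CotangentEndomorphism E M := fun ξ ↦
  ((symplecticForm ξ).toDual (symplecticForm_nondegenerate ξ)).symm.toLinearMap ∘ₗ
    exteriorDerivative (cotangentModel E) (liouvilleOf J) ξ

/-- `ω_st(J^c V, W) = d(θ(J))(V, W)`. -/
theorem symplecticForm_completeLift (ξ : CotangentBundle E M) (V W : ξ.Tangent) :
    symplecticForm ξ (J.completeLift ξ V) W =
      exteriorDerivative (cotangentModel E) (liouvilleOf J) ξ V W :=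
  LinearMap.BilinForm.apply_toDual_symm_apply
    (hB := symplecticForm_nondegenerate ξ) _ _

/-- The structure `J^c - γ(J N_J) / 2` of Sato. -/
noncomputable def satoLift : CotangentEndomorphism E M :=
  J.completeLift - (1 / 2 : ℝ) • gamma J.compNijenhuis

/-- The horizontal lift `J^{H,∇} = J^c + γ([∇'J])` of Ishihara and Yano, where `∇' = ∇ - T/2`. -/
noncomputable def horizontalLift (cov : Connection E M) : CotangentEndomorphism E M :=
  J.completeLift + gamma (bracketNabla (symmetrization cov) J)

/-- The transpose of `J` at `x`, acting on covectors. -/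
noncomputable def transpose (x : M) : CotangentSpace E x →ₗ[ℝ] CotangentSpace E x where
  toFun η := η.comp (J x)
  map_add' _ _ := rfl
  map_smul' _ _ := rfl

/-- The generalized horizontal lift `J^{G,∇}`: it is `J ⊕ ᵗJ` in the decomposition
`T_ξ T^*M = H^∇_ξ ⊕ T^*_x M`, where `H^∇_ξ` is identified with `T_x M` by `d_ξ π`. -/
noncomputable def generalizedHorizontalLift [T2Space M] (cov : Connection E M) :
    CotangentEndomorphism E M := fun ξ ↦
  Connection.horizontalLift cov ξ ∘ₗ (J ξ.proj).toLinearMap ∘ₗ (dproj ξ).toLinearMap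
    + verticalLift ξ ∘ₗ J.transpose ξ.proj ∘ₗ verticalProjection cov ξ

end AlmostComplexStructure

/-!
In the chart centred at `π(ξ)`, a tangent vector of `T^*M` at `ξ` is determined by its `dx`- and
`dp`-components. The defining equation of the complete lift, tested against vertical and against
horizontal vectors, gives the components of `J^c V` in terms of the derivative of `J` in the chart;
those of `J^{G,∇} V` are expressed by the derivatives `∇_X Z` of vector fields `Z` with constant
coefficients, since `p(Z) = ξ(∇_X Z)` describes the horizontal space. Comparing the two yields
`J^{G,∇} = J^c + γ(S)`.

As `γ` is injective, equality of two lifts is equality of the corresponding tensors on `M`. Here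
`S(X, Y) - [∇̃J](X, Y) = (T(JX, Y) - T(X, JY)) / 2` with `∇̃ = ∇ - T/2`. If `∇` is almost complex
and minimal, then `∇J = 0`, and `N_J(JX, Y) = N_J(X, JY) = -J N_J(X, Y)` gives both criteria at
once.
-/

section LieBracket

variable {𝕜 : Type*} [NontriviallyNormedField 𝕜] {E : Type*} [NormedAddCommGroup E]
  [NormedSpace 𝕜 E] {H : Type*} [TopologicalSpace H] {I : ModelWithCorners 𝕜 E H}
  {M : Type*} [TopologicalSpace M] [ChartedSpace H M] [IsManifold I 1 M]
  {x : M} {V W : ∀ x : M, TangentSpace I x} {v w : E → E}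

theorem mpullbackWithin_extChartAt_symm_eventuallyEq
    (hV : ∀ᶠ x' in 𝓝 x, V x' =
      (trivializationAt E (TangentSpace I) x).symmL 𝕜 x' (v (extChartAt I x x'))) :
    VectorField.mpullbackWithin 𝓘(𝕜, E) I (extChartAt I x).symm V (Set.range I)
      =ᶠ[𝓝[Set.range I] extChartAt I x x] v := by
  have hsymm : Filter.Tendsto (extChartAt I x).symm (𝓝[Set.range I] extChartAt I x x) (𝓝 x) := by
    simpa only [extChartAt_to_inv] using
      ((continuousAt_extChartAt_symm (I := I) x).tendsto).mono_left nhdsWithin_le_nhds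
  filter_upwards [hsymm.eventually hV, extChartAt_target_mem_nhdsWithin (I := I) x] with y hVy hy
  have hsource : (extChartAt I x).symm y ∈ (chartAt H x).source := by
    simpa only [extChartAt_source] using (extChartAt I x).map_target hy
  have hD := TangentBundle.symmL_trivializationAt (I := I) hsource
  rw [(extChartAt I x).right_inv hy] at hD hVy
  rw [VectorField.mpullbackWithin_apply, hVy, hD]
  exact (isInvertible_mfderivWithin_extChartAt_symm hy).inverse_apply_self (v y)

theorem mlieBracket_eq_lieBracketWithin
    (hV : ∀ᶠ x' in 𝓝 x, V x' =
      (trivializationAt E (TangentSpace I) x).symmL 𝕜 x' (v (extChartAt I x x')))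
    (hW : ∀ᶠ x' in 𝓝 x, W x' =
      (trivializationAt E (TangentSpace I) x).symmL 𝕜 x' (w (extChartAt I x x'))) :
    VectorField.mlieBracket I V W x =
      VectorField.lieBracketWithin 𝕜 v w (Set.range I) (extChartAt I x x) := by
  have hVv := mpullbackWithin_extChartAt_symm_eventuallyEq hV
  have hWw := mpullbackWithin_extChartAt_symm_eventuallyEq hW
  rw [VectorField.mlieBracket, VectorField.mlieBracketWithin_apply, mfderiv_extChartAt_self,
    Set.preimage_univ, Set.univ_inter,
    hVv.lieBracketWithin_vectorField_eq_of_mem hWw (Set.mem_range_self _)]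
  exact DFunLike.congr_fun ContinuousLinearMap.inverse_id _

end LieBracket

namespace Connection

section Extend

variable {E : Type*} [NormedAddCommGroup E] [NormedSpace ℝ E]
  {M : Type*} [TopologicalSpace M] [ChartedSpace E M] [IsManifold 𝓘(ℝ, E) ∞ M] {x : M}

theorem extend_eventuallyEq_symmL (X : TangentSpace 𝓘(ℝ, E) x) :
    ∀ᶠ x' in 𝓝 x, FiberBundle.extend E X x' =
      (trivializationAt E (TangentSpace 𝓘(ℝ, E)) x).symmL ℝ x' X :=
  Filter.eventually_of_mem (chart_source_mem_nhds E x) fun _ hx' ↦ Connection.extend_eq x X hx'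

theorem mlieBracket_extend_extend (X Z : TangentSpace 𝓘(ℝ, E) x) :
    VectorField.mlieBracket 𝓘(ℝ, E) (FiberBundle.extend E X) (FiberBundle.extend E Z) x = 0 := by
  have key (a b y : E) :
      VectorField.lieBracketWithin ℝ (fun _ ↦ a) (fun _ ↦ b) (Set.range 𝓘(ℝ, E)) y = 0 := by
    simp [VectorField.lieBracketWithin]
  exact (mlieBracket_eq_lieBracketWithin (E := E) (v := fun _ ↦ X) (w := fun _ ↦ Z)
    (extend_eventuallyEq_symmL X) (extend_eventuallyEq_symmL Z)).trans (key X Z _)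

end Extend

end Connection

/-- The fields of endomorphisms of the tangent spaces of `M`, that is, the tensor fields of type
`(1, 1)`, without any regularity. -/
abbrev EndomorphismField (E : Type*) [NormedAddCommGroup E] [NormedSpace ℝ E]
    (M : Type*) [TopologicalSpace M] [ChartedSpace E M] : Type _ :=
  ∀ x : M, TangentSpace 𝓘(ℝ, E) x →L[ℝ] TangentSpace 𝓘(ℝ, E) x

namespace EndomorphismField

variable {E : Type*} [NormedAddCommGroup E] [NormedSpace ℝ E]
  {M : Type*} [TopologicalSpace M] [ChartedSpace E M] [IsManifold 𝓘(ℝ, E) ∞ M]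
  (A : EndomorphismField E M)

/-- The expression of `A` in the preferred chart at `x`, an operator-valued function on the
model space. -/
noncomputable def inChart (x : M) (y : E) : E →L[ℝ] E :=
  ContinuousLinearMap.inCoordinates E (TangentSpace 𝓘(ℝ, E)) E (TangentSpace 𝓘(ℝ, E)) x
    ((extChartAt 𝓘(ℝ, E) x).symm y) x ((extChartAt 𝓘(ℝ, E) x).symm y)
    (A ((extChartAt 𝓘(ℝ, E) x).symm y))

/-- The derivative at `x` of the expression of `A` in the preferred chart at `x`, as the bilinear
map `(X, Z) ↦ (D_X A) Z`. It depends on the chart. -/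
noncomputable def chartDeriv : BilinearTensor E M := fun x ↦
  fderiv ℝ (A.inChart x) (extChartAt 𝓘(ℝ, E) x x)

theorem symmL_inChart {x x' : M} (hx' : x' ∈ (chartAt E x).source) (v : E) :
    (trivializationAt E (TangentSpace 𝓘(ℝ, E)) x).symmL ℝ x'
      (A.inChart x (extChartAt 𝓘(ℝ, E) x x') v) =
      A x' ((trivializationAt E (TangentSpace 𝓘(ℝ, E)) x).symmL ℝ x' v) := by
  rw [inChart, (extChartAt 𝓘(ℝ, E) x).left_inv (by rwa [extChartAt_source])]
  exact Trivialization.symmL_continuousLinearMapAt _ hx' _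

theorem inChart_extChartAt_self (x : M) (v : TangentSpace 𝓘(ℝ, E) x) :
    A.inChart x (extChartAt 𝓘(ℝ, E) x x) v = A x v := by
  have h := A.symmL_inChart (mem_chart_source E x) v
  rw [CotangentBundle.symmL_self] at h
  exact h.trans (congrArg (A x) (CotangentBundle.symmL_self (E := E) x v))

variable {A} {x : M}

theorem differentiableAt_inChart
    (hA : MDifferentiableAt 𝓘(ℝ, E) (𝓘(ℝ, E).prod 𝓘(ℝ, E →L[ℝ] E))
      (fun x' ↦ TotalSpace.mk' (E →L[ℝ] E) (E := fun x' ↦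
        TangentSpace 𝓘(ℝ, E) x' →L[ℝ] TangentSpace 𝓘(ℝ, E) x') x' (A x')) x) :
    DifferentiableAt ℝ (A.inChart x) (extChartAt 𝓘(ℝ, E) x x) := by
  have hcoord := ((mdifferentiableAt_hom_bundle _).1 hA).2
  have hsymm : MDifferentiableAt 𝓘(ℝ, E) 𝓘(ℝ, E) (extChartAt 𝓘(ℝ, E) x).symm
      (extChartAt 𝓘(ℝ, E) x x) := by
    simpa only [ModelWithCorners.range_eq_univ, mdifferentiableWithinAt_univ] using
      mdifferentiableWithinAt_extChartAt_symm (I := 𝓘(ℝ, E)) (mem_extChartAt_target x)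
  rw [← mdifferentiableAt_iff_differentiableAt]
  exact MDifferentiableAt.comp_of_eq _ hcoord hsymm (extChartAt_to_inv x)

theorem mlieBracket_extend_apply_extend
    (hA : MDifferentiableAt 𝓘(ℝ, E) (𝓘(ℝ, E).prod 𝓘(ℝ, E →L[ℝ] E))
      (fun x' ↦ TotalSpace.mk' (E →L[ℝ] E) (E := fun x' ↦
        TangentSpace 𝓘(ℝ, E) x' →L[ℝ] TangentSpace 𝓘(ℝ, E) x') x' (A x')) x)
    (X Z : TangentSpace 𝓘(ℝ, E) x) :
    VectorField.mlieBracket 𝓘(ℝ, E) (FiberBundle.extend E X)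
      (fun x' ↦ A x' (FiberBundle.extend E Z x')) x = A.chartDeriv x X Z := by
  have hAZ : ∀ᶠ x' in 𝓝 x, A x' (FiberBundle.extend E Z x') =
      (trivializationAt E (TangentSpace 𝓘(ℝ, E)) x).symmL ℝ x'
        (A.inChart x (extChartAt 𝓘(ℝ, E) x x') Z) := by
    filter_upwards [chart_source_mem_nhds E x, Connection.extend_eventuallyEq_symmL Z]
      with x' hx' hZ
    rw [hZ]
    exact (A.symmL_inChart hx' Z).symm
  have key (a b : E) : VectorField.lieBracketWithin ℝ (fun _ ↦ a) (fun y ↦ A.inChart x y b)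
      (Set.range 𝓘(ℝ, E)) (extChartAt 𝓘(ℝ, E) x x) =
      fderiv ℝ (A.inChart x) (extChartAt 𝓘(ℝ, E) x x) a b := by
    rw [ModelWithCorners.range_eq_univ, VectorField.lieBracketWithin_univ, VectorField.lieBracket,
      fderiv_clm_apply (differentiableAt_inChart hA) (differentiableAt_const b)]
    simp
  exact (mlieBracket_eq_lieBracketWithin (E := E) (v := fun _ ↦ X)
    (w := fun y ↦ A.inChart x y Z) (Connection.extend_eventuallyEq_symmL X) hAZ).trans (key X Z)

end EndomorphismField

namespace CotangentBundle

section Components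

variable {E : Type*} [NormedAddCommGroup E] [NormedSpace ℝ E]
  {M : Type*} [TopologicalSpace M] [ChartedSpace E M] [IsManifold 𝓘(ℝ, E) ∞ M]

/-- The `dp`-component of a tangent vector of `T^*M` at `ξ` in the preferred chart at `ξ`. It
complements the `dx`-component `dproj ξ` and, unlike it, depends on the chart. -/
def fibreComponent (ξ : CotangentBundle E M) : ξ.Tangent →ₗ[ℝ] CotangentSpace E ξ.proj :=
  LinearMap.snd ℝ E (E →L[ℝ] ℝ)

variable {ξ : CotangentBundle E M}

theorem tangent_ext {V W : ξ.Tangent} (hproj : dproj ξ V = dproj ξ W)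
    (hfibre : fibreComponent ξ V = fibreComponent ξ W) : V = W := by
  rw [dproj_apply, dproj_apply] at hproj
  exact Prod.ext hproj hfibre

theorem exists_dproj_eq_fibreComponent_eq (X : TangentSpace 𝓘(ℝ, E) ξ.proj)
    (p : CotangentSpace E ξ.proj) : ∃ V : ξ.Tangent, dproj ξ V = X ∧ fibreComponent ξ V = p :=
  ⟨((X, p) : E × (E →L[ℝ] ℝ)), dproj_apply ξ _, rfl⟩

theorem dproj_fibreVelocity (η : CotangentSpace E ξ.proj) : dproj ξ (fibreVelocity ξ η) = 0 := by
  rw [fibreVelocity_eq]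
  exact dproj_apply ξ _

theorem fibreComponent_fibreVelocity (η : CotangentSpace E ξ.proj) :
    fibreComponent ξ (fibreVelocity ξ η) = η := by
  rw [fibreVelocity_eq]
  rfl

theorem symplecticForm_eq (V W : ξ.Tangent) :
    symplecticForm ξ V W =
      fibreComponent ξ V (dproj ξ W) - fibreComponent ξ W (dproj ξ V) := by
  rw [dproj_apply, dproj_apply]
  exact symplecticForm_apply ξ V W

theorem dproj_gamma (R : BilinearTensor E M) (V : ξ.Tangent) : dproj ξ (gamma R ξ V) = 0 :=
  dproj_fibreVelocity _

theorem fibreComponent_gamma_apply (R : BilinearTensor E M) (V : ξ.Tangent)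
    (Z : TangentSpace 𝓘(ℝ, E) ξ.proj) :
    fibreComponent ξ (gamma R ξ V) Z = ξ.2 (R ξ.proj (dproj ξ V) Z) :=
  DFunLike.congr_fun (fibreComponent_fibreVelocity (ξ.2.comp (R ξ.proj (dproj ξ V)))) Z

theorem gamma_smul (c : ℝ) (R : BilinearTensor E M) (V : ξ.Tangent) :
    gamma (c • R) ξ V = c • gamma R ξ V := by
  refine tangent_ext ?_ (ContinuousLinearMap.ext fun Z ↦ ?_)
  · rw [(dproj ξ).map_smul, dproj_gamma, dproj_gamma, smul_zero]
  · rw [(fibreComponent ξ).map_smul, smul_apply, fibreComponent_gamma_apply,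
      fibreComponent_gamma_apply, Pi.smul_apply, smul_apply, smul_apply, map_smul]

theorem gamma_injective : Function.Injective (gamma (E := E) (M := M)) := by
  intro R R' h
  funext x
  refine ContinuousLinearMap.ext fun X ↦ ContinuousLinearMap.ext fun Z ↦ ?_
  by_contra hne
  obtain ⟨η, hη⟩ := SeparatingDual.exists_separating_of_ne (R := ℝ) (V := E) hne
  let ξ : CotangentBundle E M := ⟨x, η⟩
  obtain ⟨V, hV, -⟩ := exists_dproj_eq_fibreComponent_eq (ξ := ξ) X 0
  have hRR' : ξ.2 (R x X Z) = ξ.2 (R' x X Z) := by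
    rw [← hV, ← fibreComponent_gamma_apply, h, fibreComponent_gamma_apply]
  exact hη hRR'

end Components

end CotangentBundle

theorem exteriorDerivative_of_eventuallyEq {F : Type*} [NormedAddCommGroup F] [NormedSpace ℝ F]
    {H : Type*} [TopologicalSpace H] {I : ModelWithCorners ℝ F H} [I.Boundaryless]
    {N : Type*} [TopologicalSpace N] [ChartedSpace H N] [IsManifold I 1 N]
    {α : ∀ q : N, TangentSpace I q →L[ℝ] ℝ} {q : N} {f : F → F →L[ℝ] ℝ}
    (hf : (fun y ↦ (α ((extChartAt I q).symm y)).comp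
        (mfderivWithin 𝓘(ℝ, F) I (extChartAt I q).symm (Set.range I) y))
      =ᶠ[𝓝 (extChartAt I q q)] f) (u v : TangentSpace I q) :
    exteriorDerivative I α q u v =
      fderiv ℝ f (extChartAt I q q) u v - fderiv ℝ f (extChartAt I q q) v u := by
  simp only [exteriorDerivative, LinearMap.mk₂_apply, mfderiv_extChartAt_self]
  rw [ModelWithCorners.range_eq_univ, fderivWithin_univ]
  rw [ModelWithCorners.range_eq_univ] at hf
  rw [hf.fderiv_eq]
  rfl

theorem fderiv_snd_comp_comp_fst {𝕜 E F G : Type*} [NontriviallyNormedField 𝕜]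
    [NormedAddCommGroup E] [NormedSpace 𝕜 E] [NormedAddCommGroup F] [NormedSpace 𝕜 F]
    [NormedAddCommGroup G] [NormedSpace 𝕜 G] {K : E → E →L[𝕜] F} {a : E}
    (hK : DifferentiableAt 𝕜 K a) (η : F →L[𝕜] G) (A B : E × (F →L[𝕜] G)) :
    fderiv 𝕜 (fun y : E × (F →L[𝕜] G) ↦
      (y.2.comp (K y.1)).comp (ContinuousLinearMap.fst 𝕜 E (F →L[𝕜] G))) (a, η) A B =
      η (fderiv 𝕜 K a A.1 B.1) + A.2 (K a B.1) := by
  have hK' : HasFDerivAt (fun y : E × (F →L[𝕜] G) ↦ K y.1)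
      ((fderiv 𝕜 K a).comp (ContinuousLinearMap.fst 𝕜 E (F →L[𝕜] G))) (a, η) :=
    HasFDerivAt.comp (g := K) (f := Prod.fst) (a, η) hK.hasFDerivAt hasFDerivAt_fst
  rw [((hasFDerivAt_snd.clm_comp hK').clm_comp (hasFDerivAt_const _ _)).fderiv]
  simp

namespace CotangentBundle

section LiouvilleForm

variable {E : Type*} [NormedAddCommGroup E] [NormedSpace ℝ E]
  {M : Type*} [TopologicalSpace M] [ChartedSpace E M] [IsManifold 𝓘(ℝ, E) ∞ M]
  {ξ : CotangentBundle E M} {y : E × (E →L[ℝ] ℝ)}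

theorem proj_extChartAt_symm_mem (hy : y ∈ (extChartAt (cotangentModel E) ξ).target) :
    ((extChartAt (cotangentModel E) ξ).symm y).proj ∈ (chartAt E ξ.proj).source :=
  proj_mem_of_mem_source ((extChartAt (cotangentModel E) ξ).map_target hy)

theorem extChartAt_proj_extChartAt_symm (hy : y ∈ (extChartAt (cotangentModel E) ξ).target) :
    extChartAt 𝓘(ℝ, E) ξ.proj ((extChartAt (cotangentModel E) ξ).symm y).proj = y.1 := by
  rw [← extChart_fst, (extChartAt (cotangentModel E) ξ).right_inv hy]

theorem proj_extChartAt_symm (hy : y ∈ (extChartAt (cotangentModel E) ξ).target) :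
    ((extChartAt (cotangentModel E) ξ).symm y).proj = (extChartAt 𝓘(ℝ, E) ξ.proj).symm y.1 := by
  rw [← extChartAt_proj_extChartAt_symm hy, (extChartAt 𝓘(ℝ, E) ξ.proj).left_inv]
  rw [extChartAt_source]
  exact proj_extChartAt_symm_mem hy

theorem dproj_comp_mfderivWithin_extChartAt_symm
    (hy : y ∈ (extChartAt (cotangentModel E) ξ).target) :
    (dproj ((extChartAt (cotangentModel E) ξ).symm y)).comp
      (mfderivWithin 𝓘(ℝ, E × (E →L[ℝ] ℝ)) (cotangentModel E)
        (extChartAt (cotangentModel E) ξ).symm (Set.range (cotangentModel E)) y) =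
      ((trivializationAt E (TangentSpace 𝓘(ℝ, E)) ξ.proj).symmL ℝ
        ((extChartAt (cotangentModel E) ξ).symm y).proj).comp
        (ContinuousLinearMap.fst ℝ E (E →L[ℝ] ℝ)) := by
  have hy₁ : y.1 ∈ (extChartAt 𝓘(ℝ, E) ξ.proj).target := by
    rw [← extChartAt_proj_extChartAt_symm hy]
    exact (extChartAt 𝓘(ℝ, E) ξ.proj).map_source
      (by simpa only [extChartAt_source] using proj_extChartAt_symm_mem hy)
  have hchart : MDifferentiableAt 𝓘(ℝ, E × (E →L[ℝ] ℝ)) (cotangentModel E)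
      (extChartAt (cotangentModel E) ξ).symm y := by
    simpa only [ModelWithCorners.range_eq_univ, mdifferentiableWithinAt_univ] using
      mdifferentiableWithinAt_extChartAt_symm (I := cotangentModel E) hy
  have hbase : MDifferentiableAt 𝓘(ℝ, E) 𝓘(ℝ, E) (extChartAt 𝓘(ℝ, E) ξ.proj).symm y.1 := by
    simpa only [ModelWithCorners.range_eq_univ, mdifferentiableWithinAt_univ] using
      mdifferentiableWithinAt_extChartAt_symm (I := 𝓘(ℝ, E)) hy₁
  have hfst : HasMFDerivAt 𝓘(ℝ, E × (E →L[ℝ] ℝ)) 𝓘(ℝ, E) Prod.fst y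
      (ContinuousLinearMap.fst ℝ E (E →L[ℝ] ℝ)) :=
    hasFDerivAt_fst.hasMFDerivAt
  have hproj : (fun ζ : CotangentBundle E M ↦ ζ.proj) ∘ (extChartAt (cotangentModel E) ξ).symm
      =ᶠ[𝓝 y] (extChartAt 𝓘(ℝ, E) ξ.proj).symm ∘ Prod.fst :=
    Filter.eventually_of_mem ((isOpen_extChartAt_target ξ).mem_nhds hy)
      fun _ hz ↦ proj_extChartAt_symm hz
  rw [ModelWithCorners.range_eq_univ, mfderivWithin_univ, dproj,
    ← mfderiv_comp y (mdifferentiableAt_proj _) hchart, hproj.mfderiv_eq,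
    TangentBundle.symmL_trivializationAt (proj_extChartAt_symm_mem hy),
    extChartAt_proj_extChartAt_symm hy, ModelWithCorners.range_eq_univ, mfderivWithin_univ]
  exact (HasMFDerivAt.comp y hbase.hasMFDerivAt hfst).mfderiv

theorem extChartAt_self (ξ : CotangentBundle E M) :
    extChartAt (cotangentModel E) ξ ξ = (extChartAt 𝓘(ℝ, E) ξ.proj ξ.proj, ξ.2) :=
  Prod.ext (extChart_fst ξ ξ) ((extChart_snd ξ ξ).trans
    (ContinuousLinearMap.ext fun v ↦ congrArg ξ.2 (symmL_self (E := E) ξ.proj v)))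

variable (J : AlmostComplexStructure E M)

theorem liouvilleOf_comp_mfderivWithin_extChartAt_symm
    (hy : y ∈ (extChartAt (cotangentModel E) ξ).target) :
    (liouvilleOf J ((extChartAt (cotangentModel E) ξ).symm y)).comp
      (mfderivWithin 𝓘(ℝ, E × (E →L[ℝ] ℝ)) (cotangentModel E)
        (extChartAt (cotangentModel E) ξ).symm (Set.range (cotangentModel E)) y) =
      (y.2.comp (EndomorphismField.inChart J.toFun ξ.proj y.1)).comp
        (ContinuousLinearMap.fst ℝ E (E →L[ℝ] ℝ)) := by
  set ζ := (extChartAt (cotangentModel E) ξ).symm y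
  have hfibre : y.2 = ζ.2.comp
      ((trivializationAt E (TangentSpace 𝓘(ℝ, E)) ξ.proj).symmL ℝ ζ.proj) := by
    rw [← extChart_snd ξ ζ, (extChartAt (cotangentModel E) ξ).right_inv hy]
  have hJ := EndomorphismField.symmL_inChart J.toFun (proj_extChartAt_symm_mem hy)
  rw [extChartAt_proj_extChartAt_symm hy] at hJ
  rw [liouvilleOf, ContinuousLinearMap.comp_assoc, dproj_comp_mfderivWithin_extChartAt_symm hy,
    hfibre]
  exact ContinuousLinearMap.ext fun v ↦ congrArg ζ.2 (hJ v.1).symm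

theorem exteriorDerivative_liouvilleOf (ξ : CotangentBundle E M) (V W : ξ.Tangent) :
    exteriorDerivative (cotangentModel E) (liouvilleOf J) ξ V W =
      fibreComponent ξ V (J ξ.proj (dproj ξ W)) - fibreComponent ξ W (J ξ.proj (dproj ξ V))
        + (ξ.2 (EndomorphismField.chartDeriv J.toFun ξ.proj (dproj ξ V) (dproj ξ W))
          - ξ.2 (EndomorphismField.chartDeriv J.toFun ξ.proj (dproj ξ W) (dproj ξ V))) := by
  have hchart := Filter.eventually_of_mem (extChartAt_target_mem_nhds ξ)
    fun y hy ↦ liouvilleOf_comp_mfderivWithin_extChartAt_symm (ξ := ξ) (y := y) J hy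
  have hdiff := EndomorphismField.differentiableAt_inChart
    (J.contMDiff'.contMDiffAt.mdifferentiableAt (x := ξ.proj) (by simp))
  have hfderiv (V W : ξ.Tangent) : fderiv ℝ (fun y : E × (E →L[ℝ] ℝ) ↦
      (y.2.comp (EndomorphismField.inChart J.toFun ξ.proj y.1)).comp
        (ContinuousLinearMap.fst ℝ E (E →L[ℝ] ℝ))) (extChartAt (cotangentModel E) ξ ξ) V W =
      ξ.2 (EndomorphismField.chartDeriv J.toFun ξ.proj (dproj ξ V) (dproj ξ W))
        + fibreComponent ξ V (J ξ.proj (dproj ξ W)) := by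
    rw [← EndomorphismField.inChart_extChartAt_self J.toFun, dproj_apply, dproj_apply,
      extChartAt_self]
    exact fderiv_snd_comp_comp_fst hdiff ξ.2 V W
  rw [exteriorDerivative_of_eventuallyEq hchart]
  refine (congrArg₂ (· - ·) (hfderiv V W) (hfderiv W V)).trans ?_
  ring

end LiouvilleForm

end CotangentBundle

namespace AlmostComplexStructure

section CompleteLift

open CotangentBundle

variable {E : Type*} [NormedAddCommGroup E] [NormedSpace ℝ E] [FiniteDimensional ℝ E]
  {M : Type*} [TopologicalSpace M] [ChartedSpace E M] [IsManifold 𝓘(ℝ, E) ∞ M]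
  (J : AlmostComplexStructure E M) {ξ : CotangentBundle E M} (V : ξ.Tangent)

theorem dproj_completeLift : dproj ξ (J.completeLift ξ V) = J ξ.proj (dproj ξ V) := by
  refine (SeparatingDual.eq_iff_forall_dual_eq (R := ℝ) (V := E)).2 fun η ↦ ?_
  obtain ⟨W, hW, hη⟩ := exists_dproj_eq_fibreComponent_eq (ξ := ξ) 0 η
  have h := J.symplecticForm_completeLift ξ V W
  rw [symplecticForm_eq, exteriorDerivative_liouvilleOf, hW, hη] at h
  simp only [map_zero, zero_apply, zero_sub, sub_zero, add_zero, neg_inj] at h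
  exact h

theorem fibreComponent_completeLift_apply (Z : TangentSpace 𝓘(ℝ, E) ξ.proj) :
    fibreComponent ξ (J.completeLift ξ V) Z =
      fibreComponent ξ V (J ξ.proj Z)
        + (ξ.2 (EndomorphismField.chartDeriv J.toFun ξ.proj (dproj ξ V) Z)
          - ξ.2 (EndomorphismField.chartDeriv J.toFun ξ.proj Z (dproj ξ V))) := by
  obtain ⟨W, hW, hη⟩ := exists_dproj_eq_fibreComponent_eq (ξ := ξ) Z 0
  have h := J.symplecticForm_completeLift ξ V W
  rw [symplecticForm_eq, exteriorDerivative_liouvilleOf, hW, hη] at h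
  simpa only [zero_apply, sub_zero] using h

end CompleteLift

end AlmostComplexStructure

namespace Connection

section Tensors

variable {E : Type*} [NormedAddCommGroup E] [NormedSpace ℝ E] [FiniteDimensional ℝ E]
  {M : Type*} [TopologicalSpace M] [ChartedSpace E M] [IsManifold 𝓘(ℝ, E) ∞ M]
  (cov : Connection E M) (J : AlmostComplexStructure E M) {x : M}

theorem torsionTensor_apply {X Y : ∀ x : M, TangentSpace 𝓘(ℝ, E) x}
    (hX : MDiffAt (T% X) x) (hY : MDiffAt (T% Y) x) :
    torsionTensor cov x (X x) (Y x) =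
      cov.toFun Y x (X x) - cov.toFun X x (Y x) - VectorField.mlieBracket 𝓘(ℝ, E) X Y x :=
  have : CompleteSpace E := FiniteDimensional.complete ℝ E
  CovariantDerivative.torsion_apply cov hX hY

theorem torsionTensor_swap (X Y : TangentSpace 𝓘(ℝ, E) x) :
    torsionTensor cov x X Y = -torsionTensor cov x Y X :=
  have : CompleteSpace E := FiniteDimensional.complete ℝ E
  CovariantDerivative.torsion_antisymm cov X Y

theorem torsionTensor_eq_extend (X Y : TangentSpace 𝓘(ℝ, E) x) :
    torsionTensor cov x X Y =
      cov.toFun (FiberBundle.extend E Y) x X - cov.toFun (FiberBundle.extend E X) x Y := by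
  have h := torsionTensor_apply cov (FiberBundle.mdifferentiableAt_extend 𝓘(ℝ, E) E X)
    (FiberBundle.mdifferentiableAt_extend 𝓘(ℝ, E) E Y)
  simpa only [FiberBundle.extend_apply_self, mlieBracket_extend_extend,
    sub_zero] using h

theorem cov_onField_extend (X Z : TangentSpace 𝓘(ℝ, E) x) :
    cov.toFun (J.onField (FiberBundle.extend E Z)) x X =
      cov.toFun (FiberBundle.extend E (J x Z)) x X
        + EndomorphismField.chartDeriv J.toFun x X Z := by
  have h := torsionTensor_apply cov (FiberBundle.mdifferentiableAt_extend 𝓘(ℝ, E) E X)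
    (J.mdifferentiableAt_onField (FiberBundle.mdifferentiableAt_extend 𝓘(ℝ, E) E Z))
  have hbracket : VectorField.mlieBracket 𝓘(ℝ, E) (FiberBundle.extend E X)
      (J.onField (FiberBundle.extend E Z)) x = EndomorphismField.chartDeriv J.toFun x X Z :=
    EndomorphismField.mlieBracket_extend_apply_extend
      (J.contMDiff'.contMDiffAt.mdifferentiableAt (by simp)) X Z
  rw [hbracket] at h
  simp only [AlmostComplexStructure.onField, FiberBundle.extend_apply_self,
    torsionTensor_eq_extend] at h
  rw [sub_right_comm, sub_left_inj] at h
  exact eq_add_of_sub_eq h.symm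

theorem nabla_apply {X Y : ∀ x : M, TangentSpace 𝓘(ℝ, E) x}
    (hX : MDiffAt (T% X) x) (hY : MDiffAt (T% Y) x) :
    nabla cov J x (X x) (Y x) = cov.toFun (J.onField Y) x (X x) - J x (cov.toFun Y x (X x)) :=
  TensorialAt.mkHom₂_apply _ _ hX hY

theorem nabla_eq_extend (X Z : TangentSpace 𝓘(ℝ, E) x) :
    nabla cov J x X Z = cov.toFun (J.onField (FiberBundle.extend E Z)) x X
      - J x (cov.toFun (FiberBundle.extend E Z) x X) := by
  have h := nabla_apply cov J (FiberBundle.mdifferentiableAt_extend 𝓘(ℝ, E) E X)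
    (FiberBundle.mdifferentiableAt_extend 𝓘(ℝ, E) E Z)
  simpa only [FiberBundle.extend_apply_self] using h

theorem bracketNabla_apply (X Y : TangentSpace 𝓘(ℝ, E) x) :
    bracketNabla cov J x X Y = -(nabla cov J x X Y) + nabla cov J x Y X := rfl

theorem tensorS_apply (X Y : TangentSpace 𝓘(ℝ, E) x) :
    tensorS cov J x X Y = -(nabla cov J x X Y) + nabla cov J x Y X
      + torsionTensor cov x (J x X) Y - J x (torsionTensor cov x X Y) := rfl

theorem tensorS_eq_extend (X Z : TangentSpace 𝓘(ℝ, E) x) :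
    tensorS cov J x X Z =
      cov.toFun (FiberBundle.extend E Z) x (J x X) - cov.toFun (FiberBundle.extend E (J x Z)) x X
        - EndomorphismField.chartDeriv J.toFun x X Z
        + EndomorphismField.chartDeriv J.toFun x Z X := by
  simp only [tensorS_apply, nabla_eq_extend, cov_onField_extend, torsionTensor_eq_extend, map_sub]
  abel

theorem symmetrization_apply (Y : ∀ x : M, TangentSpace 𝓘(ℝ, E) x) (X : TangentSpace 𝓘(ℝ, E) x) :
    (symmetrization cov).toFun Y x X =
      cov.toFun Y x X - (1 / 2 : ℝ) • torsionTensor cov x X (Y x) :=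
  (sub_eq_add_neg _ _).symm

theorem nabla_symmetrization (X Y : TangentSpace 𝓘(ℝ, E) x) :
    nabla (symmetrization cov) J x X Y = nabla cov J x X Y
      - (1 / 2 : ℝ) • (torsionTensor cov x X (J x Y) - J x (torsionTensor cov x X Y)) := by
  simp only [nabla_eq_extend, symmetrization_apply, AlmostComplexStructure.onField,
    FiberBundle.extend_apply_self, map_sub, map_smul]
  module

theorem tensorS_sub_bracketNabla_symmetrization (X Y : TangentSpace 𝓘(ℝ, E) x) :
    tensorS cov J x X Y - bracketNabla (symmetrization cov) J x X Y =
      (1 / 2 : ℝ) • (torsionTensor cov x (J x X) Y - torsionTensor cov x X (J x Y)) := by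
  rw [tensorS_apply, bracketNabla_apply, nabla_symmetrization, nabla_symmetrization,
    torsionTensor_swap cov Y (J x X), torsionTensor_swap cov Y X, map_neg]
  module

end Tensors

end Connection

namespace Connection

open CotangentBundle

section HorizontalLift

variable {E : Type*} [NormedAddCommGroup E] [NormedSpace ℝ E] [FiniteDimensional ℝ E]
  {M : Type*} [TopologicalSpace M] [T2Space M] [ChartedSpace E M] [IsManifold 𝓘(ℝ, E) ∞ M]
  (cov : Connection E M) {ξ : CotangentBundle E M}

theorem mem_horizontalSpace_iff (V : ξ.Tangent) :
    V ∈ horizontalSpace cov ξ ↔ ∀ Z : TangentSpace 𝓘(ℝ, E) ξ.proj,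
      fibreComponent ξ V Z = ξ.2 (cov.toFun (FiberBundle.extend E Z) ξ.proj (dproj ξ V)) := by
  rw [dproj_apply]
  exact mem_horizontalSet cov ξ V.1 (fibreComponent ξ V)

theorem dproj_horizontalLift (X : TangentSpace 𝓘(ℝ, E) ξ.proj) :
    dproj ξ (horizontalLift cov ξ X) = X :=
  (LinearEquiv.ofBijective _ (bijective_dproj_horizontal cov ξ)).apply_symm_apply X

theorem horizontalLift_mem (X : TangentSpace 𝓘(ℝ, E) ξ.proj) :
    horizontalLift cov ξ X ∈ horizontalSpace cov ξ :=
  Subtype.prop _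

theorem fibreComponent_horizontalLift_apply (X Z : TangentSpace 𝓘(ℝ, E) ξ.proj) :
    fibreComponent ξ (horizontalLift cov ξ X) Z =
      ξ.2 (cov.toFun (FiberBundle.extend E Z) ξ.proj X) := by
  rw [(mem_horizontalSpace_iff cov _).1 (horizontalLift_mem cov X), dproj_horizontalLift]

theorem verticalProjection_eq (V : ξ.Tangent) :
    verticalProjection cov ξ V =
      fibreComponent ξ V - fibreComponent ξ (horizontalLift cov ξ (dproj ξ V)) := by
  set H := horizontalLift cov ξ (dproj ξ V) with hH
  have hV : V = verticalLift ξ (fibreComponent ξ V - fibreComponent ξ H) + H := by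
    refine tangent_ext ?_ ?_
    · rw [(dproj ξ).map_add, hH, dproj_horizontalLift]
      exact (add_eq_right.2 (dproj_fibreVelocity _)).symm
    · rw [(fibreComponent ξ).map_add]
      exact (eq_add_of_sub_eq (fibreComponent_fibreVelocity _).symm)
  conv_lhs => rw [hV]
  rw [verticalProjection, map_add, LinearMap.linearProjOfIsCompl_apply_left,
    LinearMap.linearProjOfIsCompl_apply_right' _ _ _ _ _ (horizontalLift_mem cov _), add_zero]

end HorizontalLift

end Connection

namespace AlmostComplexStructure

open CotangentBundle Connection

section GeneralizedHorizontalLift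

variable {E : Type*} [NormedAddCommGroup E] [NormedSpace ℝ E] [FiniteDimensional ℝ E]
  {M : Type*} [TopologicalSpace M] [T2Space M] [ChartedSpace E M] [IsManifold 𝓘(ℝ, E) ∞ M]
  (J : AlmostComplexStructure E M) (cov : Connection E M) {ξ : CotangentBundle E M}

theorem dproj_generalizedHorizontalLift (V : ξ.Tangent) :
    dproj ξ (J.generalizedHorizontalLift cov ξ V) = J ξ.proj (dproj ξ V) := by
  refine ((dproj ξ).map_add _ _).trans ?_
  exact (congrArg₂ (· + ·) (dproj_horizontalLift cov _) (dproj_fibreVelocity _)).trans (add_zero _)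

theorem fibreComponent_generalizedHorizontalLift_apply (V : ξ.Tangent)
    (Z : TangentSpace 𝓘(ℝ, E) ξ.proj) :
    fibreComponent ξ (J.generalizedHorizontalLift cov ξ V) Z =
      ξ.2 (cov.toFun (FiberBundle.extend E Z) ξ.proj (J ξ.proj (dproj ξ V)))
        + (fibreComponent ξ V (J ξ.proj Z)
          - ξ.2 (cov.toFun (FiberBundle.extend E (J ξ.proj Z)) ξ.proj (dproj ξ V))) := by
  rw [← fibreComponent_horizontalLift_apply, ← fibreComponent_horizontalLift_apply]
  have hvertical := fibreComponent_fibreVelocity ((verticalProjection cov ξ V).comp (J ξ.proj))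
  conv_rhs at hvertical => rw [verticalProjection_eq]
  exact (DFunLike.congr_fun ((fibreComponent ξ).map_add _ _) Z).trans
    (congrArg (_ + ·) (DFunLike.congr_fun hvertical Z))

theorem generalizedHorizontalLift_eq :
    J.generalizedHorizontalLift cov = J.completeLift + gamma (tensorS cov J) := by
  funext ξ
  refine LinearMap.ext fun V ↦ tangent_ext ?_ (ContinuousLinearMap.ext fun Z ↦ ?_)
  · rw [dproj_generalizedHorizontalLift, Pi.add_apply, LinearMap.add_apply, (dproj ξ).map_add,
      dproj_completeLift, dproj_gamma, add_zero]
  · rw [fibreComponent_generalizedHorizontalLift_apply, Pi.add_apply, LinearMap.add_apply,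
      (fibreComponent ξ).map_add, add_apply, fibreComponent_completeLift_apply,
      fibreComponent_gamma_apply, tensorS_eq_extend]
    simp only [map_add, map_sub]
    ring

end GeneralizedHorizontalLift

end AlmostComplexStructure

namespace AlmostComplexStructure

section Nijenhuis

variable {E : Type*} [NormedAddCommGroup E] [NormedSpace ℝ E]
  {M : Type*} [TopologicalSpace M] [ChartedSpace E M] [IsManifold 𝓘(ℝ, E) ∞ M]
  (J : AlmostComplexStructure E M)

theorem onField_onField (X : ∀ x : M, TangentSpace 𝓘(ℝ, E) x) :
    J.onField (J.onField X) = (-1 : ℝ) • X := by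
  funext x
  rw [Pi.smul_apply, neg_one_smul]
  exact J.sq' x (X x)

theorem nijenhuisField_onField_left [CompleteSpace E] {x : M}
    {X Y : ∀ x : M, TangentSpace 𝓘(ℝ, E) x} (hX : MDiffAt (T% X) x) :
    J.nijenhuisField (J.onField X) Y x = -J x (J.nijenhuisField X Y x) := by
  simp only [nijenhuisField, onField_onField]
  rw [VectorField.mlieBracket_const_smul_left hX, VectorField.mlieBracket_const_smul_left hX]
  simp only [map_sub, map_smul, J.sq']
  module

variable [FiniteDimensional ℝ E] {x : M}

theorem nijenhuis_apply {X Y : ∀ x : M, TangentSpace 𝓘(ℝ, E) x}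
    (hX : MDiffAt (T% X) x) (hY : MDiffAt (T% Y) x) :
    J.nijenhuis x (X x) (Y x) = J.nijenhuisField X Y x :=
  TensorialAt.mkHom₂_apply _ _ hX hY

theorem nijenhuis_swap (X Y : TangentSpace 𝓘(ℝ, E) x) :
    J.nijenhuis x X Y = -J.nijenhuis x Y X :=
  J.nijenhuisField_swap _ _ x

theorem nijenhuis_apply_left (X Y : TangentSpace 𝓘(ℝ, E) x) :
    J.nijenhuis x (J x X) Y = -J x (J.nijenhuis x X Y) := by
  have : CompleteSpace E := FiniteDimensional.complete ℝ E
  have hX := FiberBundle.mdifferentiableAt_extend 𝓘(ℝ, E) E X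
  have hY := FiberBundle.mdifferentiableAt_extend 𝓘(ℝ, E) E Y
  have h := J.nijenhuis_apply (J.mdifferentiableAt_onField hX) hY
  rw [J.nijenhuisField_onField_left hX, ← J.nijenhuis_apply hX hY] at h
  simpa only [onField, FiberBundle.extend_apply_self] using h

theorem nijenhuis_apply_right (X Y : TangentSpace 𝓘(ℝ, E) x) :
    J.nijenhuis x X (J x Y) = -J x (J.nijenhuis x X Y) := by
  rw [J.nijenhuis_swap X (J x Y), J.nijenhuis_apply_left, J.nijenhuis_swap X Y, map_neg]

theorem compNijenhuis_apply (X Y : TangentSpace 𝓘(ℝ, E) x) :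
    J.compNijenhuis x X Y = J x (J.nijenhuis x X Y) := rfl

end Nijenhuis

end AlmostComplexStructure

namespace Connection

section AlmostComplexMinimal

variable {E : Type*} [NormedAddCommGroup E] [NormedSpace ℝ E] [FiniteDimensional ℝ E]
  {M : Type*} [TopologicalSpace M] [ChartedSpace E M] [IsManifold 𝓘(ℝ, E) ∞ M]
  {cov : Connection E M} {J : AlmostComplexStructure E M} {x : M}

theorem IsMinimal.torsionTensor_apply_left (h : IsMinimal cov J)
    (X Y : TangentSpace 𝓘(ℝ, E) x) :
    torsionTensor cov x (J x X) Y = torsionTensor cov x X (J x Y) := by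
  rw [h x]
  simp only [smul_apply, J.nijenhuis_apply_left, J.nijenhuis_apply_right]

variable [T2Space M]

theorem IsAlmostComplex.nabla_eq_zero (h : IsAlmostComplex cov J)
    (X Y : TangentSpace 𝓘(ℝ, E) x) : nabla cov J x X Y = 0 := by
  obtain ⟨X', hX', hXX'⟩ :=
    exists_global (E := E) (F := E) (V := (TangentSpace 𝓘(ℝ, E) : M → Type _)) x X
  obtain ⟨Y', hY', hYY'⟩ :=
    exists_global (E := E) (F := E) (V := (TangentSpace 𝓘(ℝ, E) : M → Type _)) x Y
  have hnabla := nabla_apply cov J (hX'.contMDiffAt.mdifferentiableAt (x := x) (by simp))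
    (hY'.contMDiffAt.mdifferentiableAt (by simp))
  rw [h X' Y' hX' hY' x, sub_self, hXX'.self_of_nhds, hYY'.self_of_nhds] at hnabla
  simpa only [FiberBundle.extend_apply_self] using hnabla

theorem tensorS_eq_of_isAlmostComplex_of_isMinimal (h : IsAlmostComplex cov J)
    (h' : IsMinimal cov J) : tensorS cov J x = -((1 / 2 : ℝ) • J.compNijenhuis x) := by
  refine ContinuousLinearMap.ext fun X ↦ ContinuousLinearMap.ext fun Y ↦ ?_
  rw [tensorS_apply, h.nabla_eq_zero, h.nabla_eq_zero, h' x, neg_apply, neg_apply]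
  simp only [smul_apply, J.compNijenhuis_apply, J.nijenhuis_apply_left, map_smul]
  module

end AlmostComplexMinimal

end Connection

namespace AlmostComplexStructure

open CotangentBundle Connection

section Comparison

variable {E : Type*} [NormedAddCommGroup E] [NormedSpace ℝ E] [FiniteDimensional ℝ E]
  {M : Type*} [TopologicalSpace M] [ChartedSpace E M] [IsManifold 𝓘(ℝ, E) ∞ M]
  (J : AlmostComplexStructure E M)

theorem satoLift_eq :
    J.satoLift = J.completeLift + gamma (fun x ↦ -((1 / 2 : ℝ) • J.compNijenhuis x)) := by
  have hneg : (fun x ↦ -((1 / 2 : ℝ) • J.compNijenhuis x)) = (-(1 / 2) : ℝ) • J.compNijenhuis :=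
    funext fun x ↦ (neg_smul _ _).symm
  rw [hneg]
  funext ξ
  refine LinearMap.ext fun V ↦ (sub_eq_add_neg _ _).trans (congrArg (J.completeLift ξ V + ·) ?_)
  exact (neg_smul _ _).symm.trans (gamma_smul _ _ V).symm

variable [T2Space M] (cov : Connection E M)

theorem generalizedHorizontalLift_eq_satoLift_iff :
    J.generalizedHorizontalLift cov = J.satoLift ↔
      ∀ x : M, tensorS cov J x = -((1 / 2 : ℝ) • J.compNijenhuis x) := by
  rw [generalizedHorizontalLift_eq, satoLift_eq]
  exact (add_right_injective _).eq_iff.trans (gamma_injective.eq_iff.trans funext_iff)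

theorem generalizedHorizontalLift_eq_horizontalLift_iff :
    J.generalizedHorizontalLift cov = J.horizontalLift cov ↔
      ∀ (x : M) (X Y : TangentSpace 𝓘(ℝ, E) x),
        torsionTensor cov x (J x X) Y = torsionTensor cov x X (J x Y) := by
  have hpointwise (x : M) (X Y : TangentSpace 𝓘(ℝ, E) x) :
      tensorS cov J x X Y = bracketNabla (symmetrization cov) J x X Y ↔
        torsionTensor cov x (J x X) Y = torsionTensor cov x X (J x Y) := by
    rw [← sub_eq_zero, tensorS_sub_bracketNabla_symmetrization,
      smul_eq_zero_iff_right one_half_pos.ne', sub_eq_zero]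
  rw [generalizedHorizontalLift_eq, horizontalLift]
  refine (add_right_injective _).eq_iff.trans (gamma_injective.eq_iff.trans ?_)
  simp only [funext_iff, ContinuousLinearMap.ext_iff, hpointwise]

end Comparison

end AlmostComplexStructure

theorem theorem1_general {E : Type*} [NormedAddCommGroup E] [NormedSpace ℝ E]
    [FiniteDimensional ℝ E] {M : Type*} [TopologicalSpace M] [T2Space M] [ChartedSpace E M]
    [IsManifold 𝓘(ℝ, E) ∞ M] (J : AlmostComplexStructure E M) (cov : Connection E M) :
    (J.generalizedHorizontalLift cov = J.satoLift ↔
      ∀ x : M, Connection.tensorS cov J x = -((1 / 2 : ℝ) • J.compNijenhuis x)) ∧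
    (J.generalizedHorizontalLift cov = J.horizontalLift cov ↔
      ∀ (x : M) (X Y : TangentSpace 𝓘(ℝ, E) x),
        Connection.torsionTensor cov x (J x X) Y = Connection.torsionTensor cov x X (J x Y)) ∧
    (Connection.IsAlmostComplex cov J → Connection.IsMinimal cov J →
      J.generalizedHorizontalLift cov = J.satoLift ∧ J.satoLift = J.horizontalLift cov) := by
  refine ⟨J.generalizedHorizontalLift_eq_satoLift_iff cov,
    J.generalizedHorizontalLift_eq_horizontalLift_iff cov, fun hcomplex hminimal ↦ ?_⟩
  have hsato : J.generalizedHorizontalLift cov = J.satoLift :=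
    (J.generalizedHorizontalLift_eq_satoLift_iff cov).2 fun _ ↦
      Connection.tensorS_eq_of_isAlmostComplex_of_isMinimal hcomplex hminimal
  have hhorizontal : J.generalizedHorizontalLift cov = J.horizontalLift cov :=
    (J.generalizedHorizontalLift_eq_horizontalLift_iff cov).2 fun _ ↦
      hminimal.torsionTensor_apply_left
  exact ⟨hsato, hsato.symm.trans hhorizontal⟩

theorem theorem1 {E : Type*} [NormedAddCommGroup E] [NormedSpace ℝ E] [FiniteDimensional ℝ E]
    {M : Type*} [TopologicalSpace M] [T2Space M] [ChartedSpace E M] [IsManifold 𝓘(ℝ, E) ∞ M]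
    (J : AlmostComplexStructure E M) :
    (∀ cov : Connection E M, CovariantDerivative.ContMDiffCovariantDerivative cov ∞ →
      (J.generalizedHorizontalLift cov = J.satoLift ↔
        ∀ x : M, Connection.tensorS cov J x = -((1 / 2 : ℝ) • J.compNijenhuis x))) ∧
    (∀ cov : Connection E M, CovariantDerivative.ContMDiffCovariantDerivative cov ∞ →
      (J.generalizedHorizontalLift cov = J.horizontalLift cov ↔
        ∀ (x : M) (X Y : TangentSpace 𝓘(ℝ, E) x),
          Connection.torsionTensor cov x (J x X) Y = Connection.torsionTensor cov x X (J x Y))) ∧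
    (∀ cov : Connection E M, CovariantDerivative.ContMDiffCovariantDerivative cov ∞ →
      Connection.IsAlmostComplex cov J → Connection.IsMinimal cov J →
        J.generalizedHorizontalLift cov = J.satoLift ∧ J.satoLift = J.horizontalLift cov) :=
  ⟨fun cov _ ↦ (theorem1_general J cov).1, fun cov _ ↦ (theorem1_general J cov).2.1,
    fun cov _ ↦ (theorem1_general J cov).2.2⟩
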